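/- Let $\gamma>-1$ and let $\{\mu_n\}_{n\ge1}$ be a sequence of positive reals that is regularly varying of index $\gamma$, i.e. $\mu_{\lfloor\lambda n\rfloor}/\mu_n\to\lambda^\gamma$ as $n\to\infty$ for every $\lambda>0$; put $\nu_n=\sum_{k=1}^n\mu_k$. Let $p\in[0,1]$. Let $\{\xi_n\}_{n\ge1}$ be i.i.d. real random variables with $\mathbb E\xi_1=0$ and $\mathbb E\xi_1^2=1$, let $\{\alpha_n\}_{n\ge2}$ be i.i.d. Bernoulli($p$), and let $\{\beta_n\}_{n\ge2}$ be independent random variables with $\mathbb P(\beta_{n}=k)=\mu_k/\nu_{n-1}$ for $1\le k\le n-1$, the three sequences being independent of each other. Let $X_1=\xi_1$, $X_{n+1}=\alpha_{n+1}X_{\beta_{n+1}}+(1-\alpha_{n+1})\xi_{n+1}$ for $n\ge1$, and $S_n=\sum_{k=1}^nX_k$. Define $$a_n=\prod_{i=1}^{n-1}\Bigl(1+p\frac{\mu_{i+1}}{\nu_i}\Bigr)^{-1}\ (a_1=1),\qquad v_n=\Bigl(\sum_{k=1}^n a_k^2\mu_k^2\Bigr)^{1/2},\qquad \sigma_n=\frac{v_n}{a_n\mu_n}.$$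 If $p=p_c:=\frac{\gamma+1/2}{\gamma+1}$ and $\{v_n\}$ is unbounded, then, as $n\to\infty$, $$\frac{S_n}{\sigma_n}\longrightarrow N\bigl(0,(2\gamma+1)^2\bigr)\quad\text{in distribution},$$ where $N(0,0)$, which occurs only for $\gamma=-\tfrac12$ (so $p=0$), denotes the unit mass at $0$. -/

import Mathlib

open MeasureTheory ProbabilityTheory Filter Topology

namespace RVSRRW

/-- A sequence `(c n)`, `n ≥ 1`, of positive reals is regularly varying with index `ρ`.
All sequences here are indexed from `1`; the entry at `0` is never used. -/
def RegularlyVarying (c : ℕ → ℝ) (ρ : ℝ) : Prop :=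
  (∀ n, 1 ≤ n → 0 < c n) ∧
    ∀ l : ℝ, 0 < l → Tendsto (fun n : ℕ => c ⌊l * (n : ℝ)⌋₊ / c n) atTop (𝓝 (l ^ ρ))

/-- `ν n = μ 1 + ⋯ + μ n`. -/
noncomputable def nu (μ : ℕ → ℝ) (n : ℕ) : ℝ :=
  ∑ k ∈ Finset.Icc 1 n, μ k

/-- `a n = ∏_{i=1}^{n-1} (1 + p μ (i+1) / ν i)⁻¹`, with `a 1 = 1`. -/
noncomputable def a (p : ℝ) (μ : ℕ → ℝ) (n : ℕ) : ℝ :=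
  ∏ i ∈ Finset.Ico 1 n, (1 + p * (μ (i + 1) / nu μ i))⁻¹

/-- `v n` is the nonnegative root of `∑_{k=1}^n (a k)² (μ k)²`. -/
noncomputable def v (p : ℝ) (μ : ℕ → ℝ) (n : ℕ) : ℝ :=
  Real.sqrt (∑ k ∈ Finset.Icc 1 n, a p μ k ^ 2 * μ k ^ 2)

/-- `σ n` is the nonnegative root of `(a n)⁻² (μ n)⁻² ∑_{k=1}^n (a k)² (μ k)²`. -/
noncomputable def sigma (p : ℝ) (μ : ℕ → ℝ) (n : ℕ) : ℝ :=
  Real.sqrt (1 / (a p μ n ^ 2 * μ n ^ 2) * ∑ k ∈ Finset.Icc 1 n, a p μ k ^ 2 * μ k ^ 2)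

/-- The critical recollection probability `(γ + 1/2) / (γ + 1)`. -/
noncomputable def pc (γ : ℝ) : ℝ := (γ + 1 / 2) / (γ + 1)

/-- The increments along one realisation of the innovations `x`, the Bernoulli variables `e`
and the memory variables `b`: `X 1 = x 1` and
`X (n+1) = e (n+1) * X (b (n+1)) + (1 - e (n+1)) * x (n+1)` for `n ≥ 1`.
The value `0` is used if `b (n+1)` is not in `{1, …, n}`, which happens with probability zero. -/
noncomputable def increment (x e : ℕ → ℝ) (b : ℕ → ℕ) : ℕ → ℝ
  | 0 => 0
  | 1 => x 1
  | n + 2 =>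
    if _h : 1 ≤ b (n + 2) ∧ b (n + 2) < n + 2 then
      e (n + 2) * increment x e b (b (n + 2)) + (1 - e (n + 2)) * x (n + 2)
    else 0
  termination_by n => n
  decreasing_by exact _h.2

variable {Ω : Type*}

/-- The increment `X n` of the walk. -/
noncomputable def X (ξ α : ℕ → Ω → ℝ) (β : ℕ → Ω → ℕ) (n : ℕ) (ω : Ω) : ℝ :=
  increment (fun k => ξ k ω) (fun k => α k ω) (fun k => β k ω) n

/-- The walk `S n = X 1 + ⋯ + X n`. -/
noncomputable def S (ξ α : ℕ → Ω → ℝ) (β : ℕ → Ω → ℕ) (n : ℕ) (ω : Ω) : ℝ :=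
  ∑ k ∈ Finset.Icc 1 n, X ξ α β k ω

/-- The probabilistic assumptions on the variables that drive the walk: centered i.i.d.
innovations `ξ n`, `n ≥ 1`; i.i.d. Bernoulli(`p`) variables `α n`, `n ≥ 2`; independent memory
variables `β n`, `n ≥ 2`, with `P (β (n+1) = k) = μ k / ν n` for `1 ≤ k ≤ n`; the three sequences
being independent of each other. -/
structure IsDriving [MeasurableSpace Ω] (P : Measure Ω) (p : ℝ) (μ : ℕ → ℝ)
    (ξ α : ℕ → Ω → ℝ) (β : ℕ → Ω → ℕ) : Prop where
  measurable_innovation : ∀ n, 1 ≤ n → Measurable (ξ n)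
  measurable_bernoulli : ∀ n, 2 ≤ n → Measurable (α n)
  measurable_memory : ∀ n, 2 ≤ n → Measurable (β n)
  identDistrib_innovation : ∀ n, 1 ≤ n → IdentDistrib (ξ n) (ξ 1) P P
  integrable_innovation : Integrable (ξ 1) P
  mean_innovation : ∫ ω, ξ 1 ω ∂P = 0
  bernoulli_one : ∀ n, 2 ≤ n → P.real {ω | α n ω = 1} = p
  bernoulli_zero : ∀ n, 2 ≤ n → P.real {ω | α n ω = 0} = 1 - p
  memory_law : ∀ n, 1 ≤ n → ∀ k ∈ Finset.Icc 1 n, P.real {ω | β (n + 1) ω = k} = μ k / nu μ n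
  /-- Joint independence of all the variables `ξ n` (`n ≥ 1`), `α n` and `β n` (`n ≥ 2`). -/
  indep : iIndepFun
    (Sum.elim (fun n : ℕ => ξ (n + 1))
      (Sum.elim (fun n : ℕ => α (n + 2)) (fun (n : ℕ) (ω : Ω) => (β (n + 2) ω : ℝ)))) P

end RVSRRW

namespace RVSRRW

/-! Put `M n = a n * ∑ μ k * X k`. Given the past, `X (n+1)` has mean `p / ν n * ∑ μ k * X k`, and
the factor defining `a` is chosen so that this drift cancels: `M` is a martingale with differences
`a j * μ j * innov j`. The proof rests on a central limit theorem for `M n / v n` and on the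
approximation of `S n / σ n` by `(2γ+1) * M n / v n`.

Central limit theorem: conditionally on the past, `X (n+1)` is a mixture of earlier values and a
fresh innovation, so its conditional characteristic function is explicit. By `norm_mixture_sub_le`
it is a phase, which turns `a (n+1)` back into `a n`, times a Gaussian factor, up to an error
governed by the weighted mean of the `X k`, the deviation from 1 of the weighted mean of their
squares, and a truncated second moment. These tend to 0 (the first two in mean), so the errors
relative to `θ²` average out (`IsMemoryProcess.tendsto_integral_cexp`).

Approximation: summation by parts (`sum_sub_mul_weightedSum`) writes `S n` as `p * invSum n * M n`
plus a sum of orthogonal terms with bounded coefficients, of `L²` size `O(√n)`. At criticality `a n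
* μ n * invSum n → 2(γ+1)` and `p * 2(γ+1) = 2γ+1`, while unboundedness of `v` gives `n / σ n² → 0`.

The coefficient asymptotics come from Karamata's theorem and Stolz–Cesàro. The key fact is that `a n
* ν n` varies smoothly with index `(γ+1)(1-p) = 1/2` (`RegularlyVarying.smoothHalf`). -/

/-! ### Regularly varying sequences: local bounds and Karamata's theorem. -/

/-- A Steinhaus argument upgrades pointwise limits in `l` to a uniform bound. The sets `E N` of good
ratios increase to `[1,4]`, so some `E N` has measure above 5/2. The dilates `n • E N` and `m • E N`
must then meet at some `x`, and both `μ n` and `μ m` are comparable with `μ ⌊x⌋`. -/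
theorem RegularlyVarying.exists_forall_le {μ : ℕ → ℝ} {γ : ℝ} (h : RegularlyVarying μ γ) :
    ∃ K : ℝ, 1 ≤ K ∧ ∃ N : ℕ, 1 ≤ N ∧
      ∀ n m : ℕ, N ≤ n → n ≤ m → m ≤ 2 * n → μ m ≤ K * μ n ∧ μ n ≤ K * μ m := by
  obtain ⟨hpos, hlim⟩ := h
  set E : ℕ → Set ℝ := fun N => {l | l ∈ Set.Icc (1 : ℝ) 4 ∧
    ∀ n : ℕ, N < n → μ ⌊l * (n : ℝ)⌋₊ ≤ N * μ n ∧ μ n ≤ N * μ ⌊l * (n : ℝ)⌋₊} with hE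
  have hEmem : ∀ l ∈ Set.Icc (1 : ℝ) 4, ∃ N, 1 ≤ N ∧ l ∈ E N := by
    intro l hl
    have hl0 : (0 : ℝ) < l := by linarith [hl.1]
    have hlg : 0 < l ^ γ := Real.rpow_pos_of_pos hl0 γ
    have h1 := (hlim l hl0).eventually (eventually_lt_nhds (lt_add_one (l ^ γ)))
    have h2 := (hlim l hl0).eventually (eventually_gt_nhds (half_lt_self hlg))
    obtain ⟨N0, hN0⟩ := eventually_atTop.1 (h1.and h2)
    obtain ⟨N1, hN1⟩ := exists_nat_ge (l ^ γ + 1)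
    obtain ⟨N2, hN2⟩ := exists_nat_ge (l ^ γ / 2)⁻¹
    refine ⟨max (max N0 1) (max N1 N2), by simp, hl, fun n hn => ?_⟩
    have hn0 : N0 ≤ n := le_trans (by simp) hn.le
    have hn1 : 1 ≤ n := by omega
    have hM1 : (N1 : ℝ) ≤ (max (max N0 1) (max N1 N2) : ℕ) := by
      exact_mod_cast le_trans (le_max_left N1 N2) (le_max_right _ _)
    have hM2 : (N2 : ℝ) ≤ (max (max N0 1) (max N1 N2) : ℕ) := by
      exact_mod_cast le_trans (le_max_right N1 N2) (le_max_right _ _)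
    obtain ⟨ha, hb⟩ := hN0 n hn0
    have hμ := hpos n hn1
    rw [div_lt_iff₀ hμ] at ha
    rw [lt_div_iff₀ hμ] at hb
    have hfl : 0 < μ ⌊l * (n : ℝ)⌋₊ := lt_trans (by positivity) hb
    constructor
    · exact ha.le.trans (mul_le_mul_of_nonneg_right (hN1.trans hM1) hμ.le)
    · calc μ n = (l ^ γ / 2)⁻¹ * (l ^ γ / 2 * μ n) := by field_simp
        _ ≤ (l ^ γ / 2)⁻¹ * μ ⌊l * (n : ℝ)⌋₊ := by gcongr
        _ ≤ _ := by gcongr; exact hN2.trans hM2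
  have hmono : Monotone E := by
    intro N M hNM l hl
    refine ⟨hl.1, fun n hn => ?_⟩
    obtain ⟨ha, hb⟩ := hl.2 n (hNM.trans_lt hn)
    have hc : (N : ℝ) ≤ M := by exact_mod_cast hNM
    have hn1 : 1 ≤ n := by omega
    have h1 : 0 ≤ μ n := (hpos n hn1).le
    have h2 : 0 ≤ μ ⌊l * (n : ℝ)⌋₊ := by
      refine (hpos _ ?_).le
      rw [Nat.one_le_floor_iff]
      have : (1 : ℝ) ≤ n := by exact_mod_cast hn1
      nlinarith [hl.1.1]
    exact ⟨ha.trans (by gcongr), hb.trans (by gcongr)⟩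
  have hmeas : ∀ N, MeasurableSet (E N) := by
    intro N
    have hm : ∀ n : ℕ, Measurable fun l : ℝ => μ ⌊l * (n : ℝ)⌋₊ := fun n =>
      (measurable_from_nat (f := μ)).comp (Nat.measurable_floor.comp (measurable_id.mul_const _))
    have : E N = Set.Icc (1 : ℝ) 4 ∩ ⋂ n : ℕ, ⋂ _ : N < n,
        ({l : ℝ | μ ⌊l * (n : ℝ)⌋₊ ≤ N * μ n} ∩ {l : ℝ | μ n ≤ N * μ ⌊l * (n : ℝ)⌋₊}) := by
      ext l; simp [hE]
    rw [this]
    refine measurableSet_Icc.inter (MeasurableSet.iInter fun n => MeasurableSet.iInter fun _ => ?_)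
    exact (measurableSet_le (hm n) measurable_const).inter
      (measurableSet_le measurable_const ((hm n).const_mul _))
  have hunion : (⋃ N, E N) = Set.Icc (1 : ℝ) 4 := by
    ext l
    simp only [Set.mem_iUnion]
    exact ⟨fun ⟨N, hN⟩ => hN.1, fun hl => (hEmem l hl).imp fun _ h => h.2⟩
  have htend := tendsto_measure_iUnion_atTop (μ := (volume : Measure ℝ)) hmono
  rw [hunion, Real.volume_Icc] at htend
  have h52 : ENNReal.ofReal (5 / 2) < ENNReal.ofReal (4 - 1) :=
    (ENNReal.ofReal_lt_ofReal_iff (by norm_num)).2 (by norm_num)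
  obtain ⟨N, hN, hN1⟩ := ((htend.eventually (eventually_gt_nhds h52)).and
    (eventually_ge_atTop 1)).exists
  simp only [Function.comp_apply] at hN
  refine ⟨(N : ℝ) * N, by exact_mod_cast Nat.mul_pos hN1 hN1, N + 1, by omega, fun n m hn hnm hm => ?_⟩
  have hn0 : (0 : ℝ) < n := by exact_mod_cast (show 0 < n by omega)
  have hnm' : (n : ℝ) ≤ m := by exact_mod_cast hnm
  have hm' : (m : ℝ) ≤ 2 * n := by exact_mod_cast hm
  have hm0 : (0 : ℝ) < m := hn0.trans_le hnm'
  have key : ∀ r : ℝ, 0 < r → ENNReal.ofReal (r * (5 / 2)) ≤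
      volume ((fun x : ℝ => r⁻¹ * x) ⁻¹' E N) := by
    intro r hr
    rw [Real.volume_preimage_mul_left (inv_ne_zero hr.ne'), inv_inv, abs_of_pos hr,
      ENNReal.ofReal_mul hr.le]
    gcongr
  have hsub : ∀ r : ℝ, (n : ℝ) ≤ r → r ≤ m →
      (fun x : ℝ => r⁻¹ * x) ⁻¹' E N ⊆ Set.Icc (n : ℝ) (4 * m) := by
    intro r hr1 hr2 x hx
    have hr : 0 < r := hn0.trans_le hr1
    obtain ⟨h1, h4⟩ := hx.1
    simp only [inv_mul_eq_div] at h1 h4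
    rw [le_div_iff₀ hr] at h1
    rw [div_le_iff₀ hr] at h4
    exact ⟨by linarith, by linarith⟩
  -- Both dilates lie in `[n, 4m]`, whose length `4m - n` is below `(5/2)(n + m)` because `m ≤ 2n`.
  obtain ⟨x, hx1, hx2⟩ := nonempty_inter_of_measure_lt_add (volume : Measure ℝ)
    (s := (fun x : ℝ => (n : ℝ)⁻¹ * x) ⁻¹' E N) (t := (fun x : ℝ => (m : ℝ)⁻¹ * x) ⁻¹' E N)
    (u := Set.Icc (n : ℝ) (4 * m)) ((measurable_const_mul _) (hmeas N))
    (hsub n le_rfl hnm') (hsub m hnm' le_rfl) (by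
      refine lt_of_lt_of_le ?_ (add_le_add (key n hn0) (key m hm0))
      rw [Real.volume_Icc, ← ENNReal.ofReal_add (by positivity) (by positivity)]
      exact (ENNReal.ofReal_lt_ofReal_iff (by positivity)).2 (by linarith))
  have e1 := hx1.2 n hn
  have e2 := hx2.2 m (Nat.lt_of_succ_le (hn.trans hnm))
  have f1 : (n : ℝ)⁻¹ * x * n = x := by field_simp
  have f2 : (m : ℝ)⁻¹ * x * m = x := by field_simp
  simp only [f1] at e1
  simp only [f2] at e2
  constructor
  · calc μ m ≤ N * μ ⌊x⌋₊ := e2.2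
      _ ≤ N * (N * μ n) := by gcongr; exact e1.1
      _ = _ := by ring
  · calc μ n ≤ N * μ ⌊x⌋₊ := e1.2
      _ ≤ N * (N * μ m) := by gcongr; exact e2.1
      _ = _ := by ring

/-- Dominated convergence: for `l ∈ (1,2]` the index `⌊l n⌋` lies between `n` and `2n`, where the
uniform bound applies. -/
theorem RegularlyVarying.tendsto_integral {μ : ℕ → ℝ} {γ : ℝ} (h : RegularlyVarying μ γ)
    (hγ : -1 < γ) :
    Tendsto (fun n : ℕ => ∫ l in (1 : ℝ)..2, μ ⌊l * (n : ℝ)⌋₊ / μ n) atTop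
      (𝓝 ((2 ^ (γ + 1) - 1) / (γ + 1))) := by
  obtain ⟨K, hK, N, hN, hb⟩ := h.exists_forall_le
  have hI : ∫ l in (1 : ℝ)..2, l ^ γ = (2 ^ (γ + 1) - 1) / (γ + 1) := by
    rw [integral_rpow (Or.inl hγ), Real.one_rpow]
  rw [← hI]
  refine intervalIntegral.tendsto_integral_filter_of_dominated_convergence (fun _ => K) ?_ ?_
    (by simp) ?_
  · refine Eventually.of_forall fun n => Measurable.aestronglyMeasurable ?_
    exact ((measurable_from_nat (f := μ)).comp
      (Nat.measurable_floor.comp (measurable_id.mul_const _))).div_const _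
  · filter_upwards [eventually_ge_atTop N] with n hn
    refine Eventually.of_forall fun l hl => ?_
    rw [Set.uIoc_of_le (by norm_num)] at hl
    have hn0 : (1 : ℝ) ≤ n := by exact_mod_cast hN.trans hn
    have h1 : n ≤ ⌊l * (n : ℝ)⌋₊ := Nat.le_floor (by nlinarith [hl.1])
    have h2 : ⌊l * (n : ℝ)⌋₊ ≤ 2 * n := Nat.floor_le_of_le (by push_cast; nlinarith [hl.2])
    have hμ := h.1 n (hN.trans hn)
    have hμ' := h.1 _ ((hN.trans hn).trans h1)
    rw [Real.norm_of_nonneg (by positivity), div_le_iff₀ hμ]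
    exact (hb n _ hn h1 h2).1
  · refine Eventually.of_forall fun l hl => h.2 l ?_
    rw [Set.uIoc_of_le (by norm_num)] at hl
    linarith [hl.1]

theorem mul_integral_floor_eq_sum (μ : ℕ → ℝ) {n : ℕ} (hn : 1 ≤ n) :
    (n : ℝ) * ∫ l in (1 : ℝ)..2, μ ⌊l * (n : ℝ)⌋₊ = ∑ k ∈ Finset.Ico n (2 * n), μ k := by
  have hn0 : (n : ℝ) ≠ 0 := by positivity
  rw [← smul_eq_mul, intervalIntegral.smul_integral_comp_mul_right (fun x => μ ⌊x⌋₊)]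
  have heq : ∀ k : ℕ, Set.EqOn (fun _ => μ k) (fun x : ℝ => μ ⌊x⌋₊) (Set.Ioo (k : ℝ) (k + 1 : ℕ)) := by
    intro k x hx
    have : ⌊x⌋₊ = k := by
      rw [Nat.floor_eq_iff (by linarith [hx.1, (Nat.cast_nonneg k : (0 : ℝ) ≤ k)])]
      exact ⟨hx.1.le, by exact_mod_cast hx.2⟩
    simp [this]
  have hae : ∀ k : ℕ, (fun _ => μ k) =ᵐ[volume.restrict (Set.uIoc (k : ℝ) (k + 1 : ℕ))]
      (fun x : ℝ => μ ⌊x⌋₊) := by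
    intro k
    rw [Set.uIoc_of_le (by simp), ← Measure.restrict_congr_set (Ioo_ae_eq_Ioc (a := (k : ℝ)))]
    exact (ae_restrict_iff' measurableSet_Ioo).2 (Eventually.of_forall fun x hx => heq k hx)
  have := intervalIntegral.sum_integral_adjacent_intervals_Ico (μ := volume)
    (f := fun x : ℝ => μ ⌊x⌋₊) (a := fun k : ℕ => (k : ℝ)) (m := n) (n := 2 * n) (by omega) (by
      intro k _
      refine (intervalIntegrable_const (c := μ k)).congr_ae (hae k))
  rw [one_mul]
  push_cast at this ⊢
  rw [← this]
  refine Finset.sum_congr rfl fun k _ => ?_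
  have h2 := intervalIntegral.integral_congr_ae_restrict (hae k)
  push_cast at h2
  rw [← h2]
  simp

/-- Each halving of the index contracts by a factor `r < 1`. Strong induction first gives a bound
`C`; then `j` halvings give `C * r ^ j + ε`. -/
theorem tendsto_zero_of_le_mul_half {e q η : ℕ → ℝ} {q₀ : ℝ} (he : ∀ n, 0 ≤ e n)
    (hq : Tendsto q atTop (𝓝 q₀)) (hq₀ : 0 ≤ q₀) (hq₁ : q₀ < 1) (hη : Tendsto η atTop (𝓝 0))
    (h : ∀ᶠ n in atTop, e n ≤ q n * e (n / 2) + η n) : Tendsto e atTop (𝓝 0) := by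
  obtain ⟨r, hqr, hr1⟩ := exists_between hq₁
  have hr0 : 0 < r := hq₀.trans_lt hqr
  have step : ∀ ε > 0, ∀ᶠ n in atTop, e n ≤ r * e (n / 2) + ε * (1 - r) := by
    intro ε hε
    filter_upwards [h, hq.eventually (eventually_lt_nhds hqr),
      hη.eventually (eventually_lt_nhds (mul_pos hε (sub_pos.2 hr1)))] with n h1 h2 h3
    have := mul_le_mul_of_nonneg_right h2.le (he (n / 2))
    linarith
  obtain ⟨C, hC0, hC⟩ : ∃ C, 0 ≤ C ∧ ∀ n, e n ≤ C := by
    obtain ⟨N, hN⟩ := eventually_atTop.1 (step 1 one_pos)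
    refine ⟨∑ k ∈ Finset.range (N + 1), e k + 1,
      add_nonneg (Finset.sum_nonneg fun k _ => he k) zero_le_one, fun n => ?_⟩
    induction n using Nat.strong_induction_on with
    | _ n ih =>
      by_cases hn : n < N + 1
      · have := Finset.single_le_sum (fun k _ => he k) (Finset.mem_range.2 hn)
        linarith
      · have h1 := hN n (by omega)
        have h2 := ih (n / 2) (by omega)
        have h3 : 0 ≤ ∑ k ∈ Finset.range (N + 1), e k := Finset.sum_nonneg fun k _ => he k
        nlinarith
  have hiter : ∀ ε > 0, ∀ j : ℕ, ∀ᶠ n in atTop, e n ≤ C * r ^ j + ε := by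
    intro ε hε j
    induction j with
    | zero => exact Eventually.of_forall fun n => by simpa using (hC n).trans (by linarith)
    | succ j ih =>
      have hhalf : Tendsto (fun n : ℕ => n / 2) atTop atTop :=
        Nat.tendsto_div_const_atTop (by norm_num)
      filter_upwards [step ε hε, hhalf.eventually ih] with n h1 h2
      have := mul_le_mul_of_nonneg_left h2 hr0.le
      rw [pow_succ]
      linarith
  rw [Metric.tendsto_atTop']
  intro ε hε
  have hlim : Tendsto (fun j : ℕ => C * r ^ j) atTop (𝓝 0) := by
    simpa using (tendsto_pow_atTop_nhds_zero_of_lt_one hr0.le hr1).const_mul C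
  obtain ⟨j, hj⟩ := (hlim.eventually (eventually_lt_nhds (half_pos (half_pos hε)))).exists
  obtain ⟨N, hN⟩ := eventually_atTop.1 (hiter (ε / 2) (half_pos hε) j)
  refine ⟨N, fun n hn => ?_⟩
  rw [Real.dist_eq, sub_zero, abs_of_nonneg (he n)]
  linarith [hN n hn.le]

/-- `L` is the fixed point of the limiting affine recursion, so `|R n - L|` satisfies a contracting
inequality. -/
theorem tendsto_of_eq_mul_half {R q B : ℕ → ℝ} {q₀ B₀ L : ℝ}
    (hq : Tendsto q atTop (𝓝 q₀)) (hq₀ : 0 ≤ q₀) (hq₁ : q₀ < 1) (hB : Tendsto B atTop (𝓝 B₀))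
    (hL : L = q₀ * (L + B₀)) (h : ∀ᶠ n in atTop, R n = q n * (R (n / 2) + B n)) :
    Tendsto R atTop (𝓝 L) := by
  have hη : Tendsto (fun n => |q n * (L + B n) - L|) atTop (𝓝 0) := by
    have := ((hq.mul (hB.const_add L)).sub_const L).abs
    rwa [← hL, sub_self, abs_zero] at this
  have hqa : Tendsto (fun n => |q n|) atTop (𝓝 q₀) := by
    simpa [abs_of_nonneg hq₀] using hq.abs
  have := tendsto_zero_of_le_mul_half (e := fun n => |R n - L|) (fun n => abs_nonneg _) hqa hq₀ hq₁
    hη (by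
      filter_upwards [h] with n hn
      rw [hn, ← abs_mul]
      refine le_trans (le_of_eq ?_) (abs_add_le _ _)
      congr 1; ring)
  have h2 := (tendsto_zero_iff_abs_tendsto_zero _).2 this
  simpa using h2.add_const L

theorem nu_succ (μ : ℕ → ℝ) (n : ℕ) : nu μ (n + 1) = nu μ n + μ (n + 1) := by
  rw [nu, nu, Finset.sum_Icc_succ_top (by omega)]

theorem nu_pos {μ : ℕ → ℝ} (h : ∀ n, 1 ≤ n → 0 < μ n) {n : ℕ} (hn : 1 ≤ n) : 0 < nu μ n :=
  Finset.sum_pos (fun k hk => h k (Finset.mem_Icc.1 hk).1) ⟨1, by simp [hn]⟩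

/-- Karamata's theorem for the partial sums of a regularly varying sequence. -/
theorem RegularlyVarying.tendsto_nu_div {μ : ℕ → ℝ} {γ : ℝ} (h : RegularlyVarying μ γ)
    (hγ : -1 < γ) :
    Tendsto (fun n : ℕ => nu μ n / (n * μ n)) atTop (𝓝 (1 / (γ + 1))) := by
  obtain ⟨K, hK, N, hN, hb⟩ := h.exists_forall_le
  have hg : 0 < γ + 1 := by linarith
  have hq1 : (2 : ℝ) ^ (-(γ + 1)) < 1 := Real.rpow_lt_one_of_one_lt_of_neg (by norm_num) (by linarith)
  have hhalf : Tendsto (fun n : ℕ => n / 2) atTop atTop := Nat.tendsto_div_const_atTop (by norm_num)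
  set m : ℕ → ℕ := fun n => n / 2 with hm
  set J : ℕ → ℝ := fun n => ∫ l in (1 : ℝ)..2, μ ⌊l * (n : ℝ)⌋₊ / μ n with hJ
  set B : ℕ → ℝ := fun n => (nu μ n - nu μ (m n)) / (m n * μ (m n)) with hBdef
  -- Splitting `ν n` at `n / 2` gives an affine recursion for `ν n / (n μ n)`. The dyadic block
  -- contributes `B`, a Riemann sum in disguise, and `1 / (γ+1)` is the fixed point.
  refine tendsto_of_eq_mul_half (q := fun n => (m n * μ (m n)) / (n * μ n))
    (q₀ := 2 ^ (-(γ + 1))) (B := B) (B₀ := (2 ^ (γ + 1) - 1) / (γ + 1)) ?_ (by positivity) hq1 ?_ ?_ ?_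
  · have h1 := h.2 (1 / 2) (by norm_num)
    have hfl : ∀ n : ℕ, ⌊(1 / 2 : ℝ) * n⌋₊ = n / 2 := by
      intro n
      rw [one_div, inv_mul_eq_div]
      exact_mod_cast Nat.floor_div_natCast (n : ℝ) 2 |>.trans (by simp)
    simp only [hfl] at h1
    have h2 : Tendsto (fun n : ℕ => ((n / 2 : ℕ) : ℝ) / n) atTop (𝓝 (1 / 2)) := by
      have := (tendsto_nat_floor_mul_div_atTop (R := ℝ) (a := 1 / 2) (by norm_num)).comp
        tendsto_natCast_atTop_atTop
      refine this.congr fun n => ?_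
      simp only [Function.comp_apply, hfl]
    have h3 := h2.mul h1
    have e : (1 / 2 : ℝ) * (1 / 2) ^ γ = 2 ^ (-(γ + 1)) := by
      rw [Real.rpow_neg (by norm_num), Real.rpow_add (by norm_num), Real.rpow_one, one_div,
        Real.inv_rpow (by norm_num), mul_inv]
      ring
    rw [e] at h3
    refine h3.congr fun n => ?_
    simp only [hm]
    rw [div_mul_div_comm]
  · have hJm : Tendsto (fun n => J (m n)) atTop (𝓝 ((2 ^ (γ + 1) - 1) / (γ + 1))) :=
      (h.tendsto_integral hγ).comp hhalf
    have herr : Tendsto (fun n => 2 * (K * K + 1) / (m n : ℝ)) atTop (𝓝 0) :=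
      (tendsto_const_nhds (x := 2 * (K * K + 1))).div_atTop (tendsto_natCast_atTop_atTop.comp hhalf)
    have hdiff : Tendsto (fun n => B n - J (m n)) atTop (𝓝 0) := by
      refine squeeze_zero_norm' ?_ herr
      filter_upwards [hhalf.eventually_ge_atTop N] with n hn
      set k := m n with hk
      have hk1 : 1 ≤ k := hN.trans hn
      have hμk := h.1 k hk1
      have hk0 : (0 : ℝ) < k := by exact_mod_cast hk1
      have hJk : J k = (∑ i ∈ Finset.Ico k (2 * k), μ i) / (k * μ k) := by
        rw [← mul_integral_floor_eq_sum μ hk1]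
        simp only [hJ, intervalIntegral.integral_div]
        rw [mul_div_mul_left _ _ hk0.ne']
      have h2k : nu μ (2 * k) = nu μ k + (∑ i ∈ Finset.Ico k (2 * k), μ i) - μ k + μ (2 * k) := by
        have e1 : ∀ j, 1 ≤ j → nu μ j = ∑ i ∈ Finset.Ico 1 j, μ i + μ j := by
          intro j hj
          rw [nu, ← Finset.sum_Ico_succ_top hj]
          rfl
        rw [e1 (2 * k) (by omega), e1 k hk1,
          ← Finset.sum_Ico_consecutive _ hk1 (show k ≤ 2 * k by omega)]
        ring
      have hB2 : μ (2 * k) ≤ K * μ k := (hb k (2 * k) hn (by omega) le_rfl).1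
      have hpos2 := h.1 (2 * k) (by omega)
      -- The index `2k+1` exceeds `2k`, so the bound is applied twice, through `k+1`.
      have hB3 : μ (2 * k + 1) ≤ K * K * μ k := by
        have s1 := (hb (k + 1) (2 * k + 1) (by omega) (by omega) (by omega)).1
        have s2 := (hb k (k + 1) hn (by omega) (by omega)).1
        calc _ ≤ K * μ (k + 1) := s1
          _ ≤ K * (K * μ k) := by gcongr
          _ = _ := by ring
      have hpos3 := h.1 (2 * k + 1) (by omega)
      have hcases : n = 2 * k ∨ n = 2 * k + 1 := by simp only [hk, hm]; omega
      -- The block from `k` to `n` and the sum over `[k, 2k)` differ only by the end terms at `k`,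
      -- `2k` and, for odd `n`, `2k+1`. Each is `O(μ k)`, so the relative error is `O(1/k)`.
      have hnum : |nu μ n - nu μ k - ∑ i ∈ Finset.Ico k (2 * k), μ i| ≤ 2 * (K * K + 1) * μ k := by
        have hKK : K * μ k ≤ K * K * μ k := by
          have := mul_le_mul_of_nonneg_right hK (mul_nonneg (by linarith : 0 ≤ K) hμk.le)
          linarith
        rcases hcases with hc | hc
        · rw [hc, h2k, abs_le]
          constructor <;> nlinarith
        · rw [hc, nu_succ, h2k, abs_le]
          constructor <;> nlinarith
      have hBJ : B n - J k = (nu μ n - nu μ k - ∑ i ∈ Finset.Ico k (2 * k), μ i) / (k * μ k) := by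
        simp only [hBdef, hJk, ← hk]
        rw [← sub_div]
      rw [hBJ, Real.norm_eq_abs, abs_div, abs_of_pos (mul_pos hk0 hμk),
        div_le_div_iff₀ (mul_pos hk0 hμk) hk0]
      calc _ ≤ 2 * (K * K + 1) * μ k * k := by gcongr
        _ = _ := by ring
    simpa using hdiff.add hJm
  · rw [Real.rpow_neg (by norm_num)]
    have : (2 : ℝ) ^ (γ + 1) ≠ 0 := by positivity
    field_simp
    ring
  · filter_upwards [eventually_ge_atTop 2] with n hn
    have hk1 : 1 ≤ m n := by simp only [hm]; omega
    have h1 := h.1 _ hk1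
    have h2 := h.1 n (by omega)
    have h3 : (0 : ℝ) < m n := by exact_mod_cast hk1
    simp only [hBdef]
    change nu μ n / (n * μ n) = (m n * μ (m n)) / (n * μ n) *
      (nu μ (m n) / (m n * μ (m n)) + (nu μ n - nu μ (m n)) / (m n * μ (m n)))
    rw [← add_div]
    have : (n : ℝ) ≠ 0 := by positivity
    field_simp
    ring

theorem RegularlyVarying.tendsto_div_nu {μ : ℕ → ℝ} {γ : ℝ} (h : RegularlyVarying μ γ)
    (hγ : -1 < γ) :
    Tendsto (fun n : ℕ => n * μ n / nu μ n) atTop (𝓝 (γ + 1)) := by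
  have := (h.tendsto_nu_div hγ).inv₀ (by have : 0 < γ + 1 := by linarith
                                         positivity)
  simpa using this

/-! ### Stolz–Cesàro and sequences of index one half. -/

/-- Stolz–Cesàro: the increments of `F` minus `l * g` are `o(g)`, and this passes to partial sums
since those of `g` diverge. -/
theorem tendsto_div_sum_range_of_tendsto_sub_div {F g : ℕ → ℝ} {l : ℝ} (hg : ∀ k, 0 < g k)
    (hG : Tendsto (fun n => ∑ i ∈ Finset.range n, g i) atTop atTop)
    (h : Tendsto (fun k => (F (k + 1) - F k) / g k) atTop (𝓝 l)) :
    Tendsto (fun n => F n / ∑ i ∈ Finset.range n, g i) atTop (𝓝 l) := by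
  have h1 : (fun k => F (k + 1) - F k - l * g k) =o[atTop] g := by
    rw [Asymptotics.isLittleO_iff_tendsto fun k hk => absurd hk (hg k).ne']
    have := h.sub_const l
    rw [sub_self] at this
    refine this.congr fun k => ?_
    rw [sub_div (F (k + 1) - F k), mul_div_cancel_right₀ _ (hg k).ne']
  have h2 := (h1.sum_range (fun k => (hg k).le) hG).tendsto_div_nhds_zero
  have h3 : Tendsto (fun n => F 0 / ∑ i ∈ Finset.range n, g i) atTop (𝓝 0) :=
    tendsto_const_nhds.div_atTop hG
  have h4 := (h2.add h3).add_const l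
  simp only [zero_add] at h4
  refine h4.congr' ?_
  filter_upwards [hG.eventually_gt_atTop 0] with n hn
  rw [Finset.sum_sub_distrib, Finset.sum_range_sub, ← Finset.mul_sum]
  field_simp
  ring

theorem tendsto_sum_range_atTop_of_eventually_le {g : ℕ → ℝ} {c : ℝ} (hc : 0 < c)
    (hg : ∀ k, 0 < g k) (h : ∀ᶠ k : ℕ in atTop, c / ((k : ℝ) + 1) ≤ g k) :
    Tendsto (fun n => ∑ i ∈ Finset.range n, g i) atTop atTop := by
  rw [← not_summable_iff_tendsto_nat_atTop_of_nonneg fun k => (hg k).le]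
  intro hs
  have h1 : Summable fun k : ℕ => c / ((k : ℝ) + 1) := by
    refine Summable.of_norm_bounded_eventually_nat hs ?_
    filter_upwards [h] with k hk
    rwa [Real.norm_of_nonneg (by positivity)]
  have h2 : Summable fun k : ℕ => 1 / ((k + 1 : ℕ) : ℝ) := by
    refine (h1.mul_left c⁻¹).congr fun k => ?_
    push_cast
    field_simp
  exact Real.not_summable_one_div_natCast ((summable_nat_add_iff 1).1 h2)

/-- A positive sequence `b` varies smoothly with index `1 / 2`. -/
def SmoothHalf (b : ℕ → ℝ) : Prop :=
  (∀ k, 0 < b k) ∧ Tendsto (fun k : ℕ => ((k : ℝ) + 1) * (b (k + 1) / b k - 1)) atTop (𝓝 (1 / 2))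

namespace SmoothHalf

variable {b : ℕ → ℝ}

theorem succ_eq (hb : SmoothHalf b) (k : ℕ) :
    b (k + 1) = b k * (1 + ((k : ℝ) + 1) * (b (k + 1) / b k - 1) / ((k : ℝ) + 1)) := by
  have := (hb.1 k).ne'
  field_simp
  ring

/-- Index below 1 makes `b` grow at most linearly, so the reciprocals dominate a harmonic series. -/
theorem tendsto_sum_inv (hb : SmoothHalf b) :
    Tendsto (fun n => ∑ i ∈ Finset.range n, (b i)⁻¹) atTop atTop := by
  obtain ⟨N, hN⟩ := eventually_atTop.1 (hb.2.eventually (eventually_lt_nhds (by norm_num : (1 / 2 : ℝ) < 1)))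
  have hbd : ∀ k, N ≤ k → b k ≤ b N / (N + 1) * (k + 1) := by
    intro k hk
    induction k, hk using Nat.le_induction with
    | base => field_simp; exact le_rfl
    | succ k hk ih =>
      have h1 := hN k hk
      have hbk := hb.1 k
      rw [hb.succ_eq k]
      have h2 : 1 + ((k : ℝ) + 1) * (b (k + 1) / b k - 1) / ((k : ℝ) + 1) ≤ ((k : ℝ) + 2) / (k + 1) := by
        rw [← sub_nonneg]
        have : ((k : ℝ) + 2) / (k + 1) - (1 + ((k : ℝ) + 1) * (b (k + 1) / b k - 1) / ((k : ℝ) + 1)) =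
          (1 - ((k : ℝ) + 1) * (b (k + 1) / b k - 1)) / (k + 1) := by field_simp; ring
        rw [this]
        exact div_nonneg (by linarith) (by positivity)
      calc _ ≤ b k * (((k : ℝ) + 2) / (k + 1)) := by gcongr
        _ ≤ (b N / (N + 1) * (k + 1)) * (((k : ℝ) + 2) / (k + 1)) := by gcongr
        _ = _ := by push_cast; field_simp; ring
  have hbN := hb.1 N
  refine tendsto_sum_range_atTop_of_eventually_le (c := (b N / (N + 1))⁻¹) (by positivity)
    (fun k => inv_pos.2 (hb.1 k)) ?_
  filter_upwards [eventually_ge_atTop N] with k hk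
  rw [div_eq_mul_inv, ← mul_inv]
  exact inv_anti₀ (hb.1 k) (hbd k hk)

/-- Positive index makes `b` eventually nondecreasing, hence bounded below. -/
theorem tendsto_sum_sq_div (hb : SmoothHalf b) :
    Tendsto (fun n => ∑ i ∈ Finset.range n, b i ^ 2 / ((i : ℝ) + 1)) atTop atTop := by
  obtain ⟨N, hN⟩ := eventually_atTop.1 (hb.2.eventually (eventually_gt_nhds (by norm_num : (0 : ℝ) < 1 / 2)))
  have hbd : ∀ k, N ≤ k → b N ≤ b k := by
    intro k hk
    induction k, hk using Nat.le_induction with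
    | base => exact le_rfl
    | succ k hk ih =>
      refine ih.trans ?_
      have h1 := hN k hk
      rw [hb.succ_eq k]
      refine le_mul_of_one_le_right (hb.1 k).le ?_
      have : 0 < ((k : ℝ) + 1) * (b (k + 1) / b k - 1) / ((k : ℝ) + 1) := by positivity
      linarith
  have hbN := hb.1 N
  refine tendsto_sum_range_atTop_of_eventually_le (c := b N ^ 2) (by positivity)
    (fun k => div_pos (pow_pos (hb.1 k) 2) (by positivity)) ?_
  filter_upwards [eventually_ge_atTop N] with k hk
  have := hbd k hk
  gcongr

theorem tendsto_inv_succ : Tendsto (fun k : ℕ => 1 / ((k : ℝ) + 1)) atTop (𝓝 0) :=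
  tendsto_one_div_add_atTop_nhds_zero_nat

/-- Stolz–Cesàro for `(k+1) / b k` against `∑ 1 / b`: the ratio of increments tends to `1 - 1/2`. -/
theorem tendsto_sum_inv_mul (hb : SmoothHalf b) :
    Tendsto (fun k : ℕ => (∑ i ∈ Finset.range k, (b i)⁻¹) * b k / ((k : ℝ) + 1)) atTop (𝓝 2) := by
  have h := tendsto_div_sum_range_of_tendsto_sub_div (F := fun k => ((k : ℝ) + 1) / b k) (l := 1 / 2)
    (fun k => inv_pos.2 (hb.1 k)) hb.tendsto_sum_inv (by
      set r : ℕ → ℝ := fun k => ((k : ℝ) + 1) * (b (k + 1) / b k - 1) with hr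
      have h1 : Tendsto (fun k : ℕ => (1 - r k) / (1 + r k * (1 / ((k : ℝ) + 1)))) atTop
          (𝓝 ((1 - 1 / 2) / (1 + 1 / 2 * 0))) :=
        (hb.2.const_sub 1).div ((hb.2.mul tendsto_inv_succ).const_add 1) (by norm_num)
      norm_num at h1
      norm_num
      refine h1.congr fun k => ?_
      have h2 := (hb.1 k).ne'
      have h3 := (hb.1 (k + 1)).ne'
      have e1 : 1 + r k * ((k : ℝ) + 1)⁻¹ = b (k + 1) / b k := by
        simp only [hr]; field_simp; ring
      rw [e1]
      simp only [hr]
      field_simp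
      ring)
  have h2 := h.inv₀ (by norm_num)
  norm_num at h2
  refine h2.congr fun k => ?_
  rw [div_div_eq_mul_div]

variable {c : ℕ → ℝ} {κ : ℝ}

/-- Both `∑ c` and `b²` are compared with `∑ b² / (i+1)`. Since `c` is of order `b² / (i+1)²`, the
first ratio vanishes; the second tends to `2 * (1/2) = 1`. -/
theorem tendsto_sum_div_sq (hb : SmoothHalf b)
    (hc : Tendsto (fun k : ℕ => c k * ((k : ℝ) + 1) ^ 2 / b k ^ 2) atTop (𝓝 κ)) :
    Tendsto (fun k => (∑ i ∈ Finset.range (k + 1), c i) / b k ^ 2) atTop (𝓝 0) := by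
  have hg : ∀ k, 0 < b k ^ 2 / ((k : ℝ) + 1) := fun k => div_pos (pow_pos (hb.1 k) 2) (by positivity)
  have hck : Tendsto (fun k : ℕ => c k * ((k : ℝ) + 1) ^ 2 / b k ^ 2 * (1 / ((k : ℝ) + 1))) atTop
      (𝓝 0) := by simpa using hc.mul tendsto_inv_succ
  have h1 := tendsto_div_sum_range_of_tendsto_sub_div
    (F := fun k => ∑ i ∈ Finset.range k, c i) (l := 0) hg hb.tendsto_sum_sq_div (by
      refine hck.congr fun k => ?_
      have h2 := (hb.1 k).ne'
      rw [Finset.sum_range_succ]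
      field_simp
      ring)
  have h2 := tendsto_div_sum_range_of_tendsto_sub_div
    (F := fun k => b k ^ 2) (l := 1) hg hb.tendsto_sum_sq_div (by
      set r : ℕ → ℝ := fun k => ((k : ℝ) + 1) * (b (k + 1) / b k - 1) with hr
      have h1 : Tendsto (fun k : ℕ => 2 * r k + r k * r k * (1 / ((k : ℝ) + 1))) atTop
          (𝓝 (2 * (1 / 2) + 1 / 2 * (1 / 2) * 0)) :=
        (hb.2.const_mul 2).add ((hb.2.mul hb.2).mul tendsto_inv_succ)
      norm_num at h1
      refine h1.congr fun k => ?_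
      have h2 := (hb.1 k).ne'
      simp only [hr]
      field_simp
      ring)
  have h3 := h1.div h2 one_ne_zero
  have h4 := h3.add (hck.mul tendsto_inv_succ)
  norm_num at h4
  refine h4.congr' ?_
  filter_upwards [hb.tendsto_sum_sq_div.eventually_gt_atTop 0] with k hk
  have h2 := (hb.1 k).ne'
  rw [div_div_div_cancel_right₀ hk.ne', Finset.sum_range_succ]
  field_simp

/-- Here `(k+1) * c k` is of order `b² / (k+1)`, which is slowly varying exactly because the index
is 1/2. Its increments are therefore negligible against `c`, and Stolz–Cesàro needs only the
divergence of `∑ c`. -/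
theorem tendsto_mul_div_sum (hb : SmoothHalf b) (hκ : 0 < κ) (hc0 : ∀ k, 0 < c k)
    (hc : Tendsto (fun k : ℕ => c k * ((k : ℝ) + 1) ^ 2 / b k ^ 2) atTop (𝓝 κ))
    (hV : Tendsto (fun n => ∑ i ∈ Finset.range n, c i) atTop atTop) :
    Tendsto (fun k : ℕ => ((k : ℝ) + 1) * c k / ∑ i ∈ Finset.range (k + 1), c i) atTop (𝓝 0) := by
  have h1 := tendsto_div_sum_range_of_tendsto_sub_div
    (F := fun k => b k ^ 2 / ((k : ℝ) + 1)) (l := 0) hc0 hV (by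
      set r : ℕ → ℝ := fun k => ((k : ℝ) + 1) * (b (k + 1) / b k - 1) with hr
      -- The leading term `2 * (1/2) - 1` vanishes: this is where the critical index enters.
      have h1 : Tendsto (fun k : ℕ => (2 * r k - 1 + r k * r k * (1 / ((k : ℝ) + 1))) /
          (c k * ((k : ℝ) + 1) ^ 2 / b k ^ 2 * (1 + 1 / ((k : ℝ) + 1)))) atTop
          (𝓝 ((2 * (1 / 2) - 1 + 1 / 2 * (1 / 2) * 0) / (κ * (1 + 0)))) :=
        (((hb.2.const_mul 2).sub_const 1).add ((hb.2.mul hb.2).mul tendsto_inv_succ)).div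
          (hc.mul (tendsto_inv_succ.const_add 1)) (by simpa using hκ.ne')
      norm_num at h1
      refine h1.congr fun k => ?_
      have h2 := (hb.1 k).ne'
      have h3 := (hc0 k).ne'
      have h4 : (k : ℝ) + 1 + 1 ≠ 0 := by positivity
      have h5 : 1 + ((k : ℝ) + 1)⁻¹ ≠ 0 := by positivity
      simp only [hr]
      push_cast
      field_simp
      ring)
  have h2 := hc.mul h1
  rw [mul_zero] at h2
  refine squeeze_zero' (Eventually.of_forall fun k => ?_) ?_ h2
  · have := Finset.sum_nonneg fun i (_ : i ∈ Finset.range (k + 1)) => (hc0 i).le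
    have := (hc0 k).le
    positivity
  · filter_upwards [hV.eventually_gt_atTop 0] with k hk
    have h3 := hc0 k
    have h4 := (hb.1 k).ne'
    have e : c k * ((k : ℝ) + 1) ^ 2 / b k ^ 2 * (b k ^ 2 / ((k : ℝ) + 1) / ∑ i ∈ Finset.range k, c i) =
        ((k : ℝ) + 1) * c k / ∑ i ∈ Finset.range k, c i := by field_simp
    rw [e, Finset.sum_range_succ]
    gcongr
    linarith

end SmoothHalf

/-! ### Asymptotics of the coefficients `a`, `v` and `σ`. -/

section Coefficients

variable {μ : ℕ → ℝ} {γ p : ℝ}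

theorem a_succ (p : ℝ) (μ : ℕ → ℝ) {n : ℕ} (hn : 1 ≤ n) :
    a p μ (n + 1) = a p μ n * (1 + p * (μ (n + 1) / nu μ n))⁻¹ := by
  rw [a, a, Finset.prod_Ico_succ_top hn]

theorem one_add_pos (h : ∀ n, 1 ≤ n → 0 < μ n) (hp : 0 ≤ p) {n : ℕ} (hn : 1 ≤ n) :
    0 < 1 + p * (μ (n + 1) / nu μ n) := by
  have := h (n + 1) (by omega)
  have := nu_pos h hn
  positivity

theorem a_pos (h : ∀ n, 1 ≤ n → 0 < μ n) (hp : 0 ≤ p) (n : ℕ) : 0 < a p μ n :=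
  Finset.prod_pos fun _ hi => inv_pos.2 (one_add_pos h hp (Finset.mem_Ico.1 hi).1)

theorem a_eq_mul_succ (h : ∀ n, 1 ≤ n → 0 < μ n) (hp : 0 ≤ p) {n : ℕ} (hn : 1 ≤ n) :
    a p μ n = a p μ (n + 1) * (1 + p * (μ (n + 1) / nu μ n)) := by
  rw [a_succ p μ hn, mul_assoc, inv_mul_cancel₀ (one_add_pos h hp hn).ne', mul_one]

theorem sum_Icc_one_eq_sum_range (f : ℕ → ℝ) (n : ℕ) :
    ∑ k ∈ Finset.Icc 1 n, f k = ∑ k ∈ Finset.range n, f (k + 1) := by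
  rw [Finset.range_eq_Ico, Finset.sum_Ico_add' f 0 n 1]
  rfl

theorem v_sq (p : ℝ) (μ : ℕ → ℝ) (n : ℕ) :
    v p μ n ^ 2 = ∑ k ∈ Finset.range n, (a p μ (k + 1) * μ (k + 1)) ^ 2 := by
  rw [v, Real.sq_sqrt (Finset.sum_nonneg fun k _ => by positivity), sum_Icc_one_eq_sum_range]
  simp only [mul_pow]

theorem v_nonneg (p : ℝ) (μ : ℕ → ℝ) (n : ℕ) : 0 ≤ v p μ n := Real.sqrt_nonneg _

theorem v_pos (h : ∀ n, 1 ≤ n → 0 < μ n) (hp : 0 ≤ p) {n : ℕ} (hn : 1 ≤ n) : 0 < v p μ n := by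
  refine Real.sqrt_pos.2 (Finset.sum_pos (fun k hk => ?_) ⟨1, by simp [hn]⟩)
  have := a_pos h hp k
  have := h k (Finset.mem_Icc.1 hk).1
  positivity

theorem v_mono (p : ℝ) (μ : ℕ → ℝ) : Monotone (v p μ) := by
  refine monotone_nat_of_le_succ fun n => Real.sqrt_le_sqrt ?_
  rw [Finset.sum_Icc_succ_top (by omega)]
  exact le_add_of_nonneg_right (by positivity)

theorem tendsto_v (hv : ¬ BddAbove (Set.range (v p μ))) : Tendsto (v p μ) atTop atTop :=
  tendsto_atTop_atTop_of_monotone' (v_mono p μ) hv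

theorem sigma_eq (h : ∀ n, 1 ≤ n → 0 < μ n) (hp : 0 ≤ p) {n : ℕ} (hn : 1 ≤ n) :
    sigma p μ n = v p μ n / (a p μ n * μ n) := by
  have := a_pos h hp n
  have := h n hn
  rw [sigma, ← mul_pow, Real.sqrt_mul (by positivity), ← v, one_div, Real.sqrt_inv,
    Real.sqrt_sq (by positivity)]
  ring

/-- With `x = μ (n+1) / ν n ∼ (γ+1)/n`, consecutive terms have ratio `(1+x)/(1+p x)`, so the index
is `(γ+1)(1-p)`, which is 1/2 at `p = pc γ`. -/
theorem RegularlyVarying.smoothHalf (h : RegularlyVarying μ γ) (hγ : -1 < γ) (hp : 0 ≤ p)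
    (hcrit : p = pc γ) : SmoothHalf fun k => a p μ (k + 1) * nu μ (k + 1) := by
  have hg : 0 < γ + 1 := by linarith
  refine ⟨fun k => mul_pos (a_pos h.1 hp _) (nu_pos h.1 (by omega)), ?_⟩
  set x : ℕ → ℝ := fun k => μ (k + 1 + 1) / nu μ (k + 1) with hx
  have hx0 : ∀ k, 0 < x k := fun k => div_pos (h.1 _ (by omega)) (nu_pos h.1 (by omega))
  set u : ℕ → ℝ := fun k => (((k + 1 + 1 : ℕ) : ℝ) * μ (k + 1 + 1) / nu μ (k + 1 + 1)) with hu
  have hlu : Tendsto u atTop (𝓝 (γ + 1)) := (tendsto_add_atTop_iff_nat 2).2 (h.tendsto_div_nu hγ)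
  have hi : Tendsto (fun k : ℕ => 1 / ((k + 1 : ℕ) + 1 : ℝ)) atTop (𝓝 0) :=
    (tendsto_add_atTop_iff_nat 1).2 SmoothHalf.tendsto_inv_succ
  -- Karamata controls `μ (k+2) / ν (k+2)`; the change of denominator to `ν (k+1)` costs a factor `1
  -- - u k / (k+2)`, which tends to 1.
  have hlx : Tendsto (fun k : ℕ => ((k : ℝ) + 1) * x k) atTop (𝓝 (γ + 1)) := by
    have h1 : Tendsto (fun k : ℕ => u k * (1 - 1 / ((k + 1 : ℕ) + 1 : ℝ)) /
        (1 - u k * (1 / ((k + 1 : ℕ) + 1 : ℝ)))) atTop (𝓝 ((γ + 1) * (1 - 0) / (1 - (γ + 1) * 0))) :=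
      (hlu.mul (hi.const_sub 1)).div ((hlu.mul hi).const_sub 1) (by norm_num)
    rw [sub_zero, mul_one, mul_zero, sub_zero, div_one] at h1
    refine h1.congr fun k => ?_
    have hn1 := nu_pos h.1 (show 1 ≤ k + 1 by omega)
    have hn2 := nu_pos h.1 (show 1 ≤ k + 1 + 1 by omega)
    have e : 1 - u k * (1 / ((k + 1 : ℕ) + 1 : ℝ)) = nu μ (k + 1) / nu μ (k + 1 + 1) := by
      simp only [hu]
      have e1 : nu μ (k + 1) = nu μ (k + 1 + 1) - μ (k + 1 + 1) := by
        rw [nu_succ μ (k + 1)]; ring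
      rw [e1]
      push_cast
      field_simp
    rw [e]
    simp only [hx, hu]
    push_cast
    field_simp
    ring
  have hx1 : Tendsto x atTop (𝓝 0) := by
    have := hlx.mul SmoothHalf.tendsto_inv_succ
    rw [mul_zero] at this
    refine this.congr fun k => ?_
    field_simp
  have h1 : Tendsto (fun k : ℕ => ((k : ℝ) + 1) * x k * (1 - p) / (1 + p * x k)) atTop
      (𝓝 ((γ + 1) * (1 - p) / (1 + p * 0))) :=
    (hlx.mul_const _).div ((hx1.const_mul p).const_add 1) (by norm_num)
  have e : (γ + 1) * (1 - p) / (1 + p * 0) = 1 / 2 := by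
    rw [hcrit, pc]; field_simp; ring
  rw [e] at h1
  refine h1.congr fun k => ?_
  have hn1 := nu_pos h.1 (show 1 ≤ k + 1 by omega)
  have hpx : 0 < 1 + p * x k := one_add_pos h.1 hp (show 1 ≤ k + 1 by omega)
  have ha := a_pos h.1 hp (k + 1)
  have e2 : nu μ (k + 1 + 1) = nu μ (k + 1) * (1 + x k) := by
    rw [nu_succ]; simp only [hx]; field_simp
  have e3 : a p μ (k + 1 + 1) = a p μ (k + 1) * (1 + p * x k)⁻¹ := a_succ p μ (by omega)
  simp only [e2, e3]
  have hpx' := hpx.ne'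
  clear_value x
  generalize x k = y at *
  have e4 : a p μ (k + 1) * (1 + p * y)⁻¹ * (nu μ (k + 1) * (1 + y)) /
      (a p μ (k + 1) * nu μ (k + 1)) = (1 + y) / (1 + p * y) := by field_simp
  rw [e4, div_sub_one hpx', ← mul_div_assoc]
  ring

/-- `∑_{k=1}^{n-1} 1 / (a k * ν k)`. -/
noncomputable def invSum (p : ℝ) (μ : ℕ → ℝ) (n : ℕ) : ℝ :=
  ∑ k ∈ Finset.range (n - 1), (a p μ (k + 1) * nu μ (k + 1))⁻¹

theorem invSum_succ (p : ℝ) (μ : ℕ → ℝ) {n : ℕ} (hn : 1 ≤ n) :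
    invSum p μ (n + 1) = invSum p μ n + (a p μ n * nu μ n)⁻¹ := by
  obtain ⟨k, rfl⟩ := Nat.exists_eq_add_of_le' hn
  rw [invSum, invSum, Nat.add_sub_cancel, Nat.add_sub_cancel, Finset.sum_range_succ]

/-- The 2 comes from the index 1/2 of `a ν`, and the `γ+1` from Karamata's theorem. -/
theorem RegularlyVarying.tendsto_mul_invSum (h : RegularlyVarying μ γ) (hγ : -1 < γ) (hp : 0 ≤ p)
    (hcrit : p = pc γ) :
    Tendsto (fun n => a p μ n * μ n * invSum p μ n) atTop (𝓝 (2 * (γ + 1))) := by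
  refine (tendsto_add_atTop_iff_nat 1).1 ?_
  refine ((h.smoothHalf hγ hp hcrit).tendsto_sum_inv_mul.mul
    ((tendsto_add_atTop_iff_nat 1).2 (h.tendsto_div_nu hγ))).congr fun k => ?_
  have := nu_pos h.1 (show 1 ≤ k + 1 by omega)
  rw [invSum, Nat.add_sub_cancel]
  push_cast
  field_simp

theorem RegularlyVarying.tendsto_sq_mul_div (h : RegularlyVarying μ γ) (hγ : -1 < γ) (hp : 0 ≤ p) :
    Tendsto (fun k : ℕ => (a p μ (k + 1) * μ (k + 1)) ^ 2 * ((k : ℝ) + 1) ^ 2 /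
      (a p μ (k + 1) * nu μ (k + 1)) ^ 2) atTop (𝓝 ((γ + 1) ^ 2)) := by
  refine (((tendsto_add_atTop_iff_nat 1).2 (h.tendsto_div_nu hγ)).pow 2).congr fun k => ?_
  have := nu_pos h.1 (show 1 ≤ k + 1 by omega)
  have := a_pos h.1 hp (k + 1)
  push_cast
  field_simp

/-- This makes the weighted averages vanish in `L²`. -/
theorem RegularlyVarying.tendsto_v_sq_div (h : RegularlyVarying μ γ) (hγ : -1 < γ) (hp : 0 ≤ p)
    (hcrit : p = pc γ) :
    Tendsto (fun n => v p μ n ^ 2 / (a p μ n * nu μ n) ^ 2) atTop (𝓝 0) := by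
  refine (tendsto_add_atTop_iff_nat 1).1 ?_
  refine ((h.smoothHalf hγ hp hcrit).tendsto_sum_div_sq (h.tendsto_sq_mul_div hγ hp)).congr
    fun k => ?_
  rw [v_sq]

/-- This says `n / σ n² → 0`, so fluctuations of order `√n` disappear after normalization. It is
where the growth of `v` is needed for the approximation of `S n`. -/
theorem RegularlyVarying.tendsto_mul_sq_div_v_sq (h : RegularlyVarying μ γ) (hγ : -1 < γ)
    (hp : 0 ≤ p) (hcrit : p = pc γ) (hv : ¬ BddAbove (Set.range (v p μ))) :
    Tendsto (fun n : ℕ => n * (a p μ n * μ n) ^ 2 / v p μ n ^ 2) atTop (𝓝 0) := by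
  refine (tendsto_add_atTop_iff_nat 1).1 ?_
  have hV : Tendsto (fun n => v p μ n ^ 2) atTop atTop :=
    (tendsto_pow_atTop two_ne_zero).comp (tendsto_v hv)
  simp only [v_sq] at hV
  refine ((h.smoothHalf hγ hp hcrit).tendsto_mul_div_sum (κ := (γ + 1) ^ 2)
    (pow_pos (by linarith) 2) (fun k => ?_) (h.tendsto_sq_mul_div hγ hp) hV).congr fun k => ?_
  · exact pow_pos (mul_pos (a_pos h.1 hp _) (h.1 _ (by omega))) 2
  · rw [v_sq]
    push_cast
    rfl

end Coefficients

/-! ### The driving variables, the history and the one-step transition. -/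

variable {Ω : Type*}

/-- The variables that drive the walk, as one family. -/
noncomputable def driver (ξ α : ℕ → Ω → ℝ) (β : ℕ → Ω → ℕ) : ℕ ⊕ ℕ ⊕ ℕ → Ω → ℝ :=
  Sum.elim (fun n : ℕ => ξ (n + 1))
    (Sum.elim (fun n : ℕ => α (n + 2)) (fun (n : ℕ) (ω : Ω) => (β (n + 2) ω : ℝ)))

/-- The `σ`-algebra generated by the driving variables with indices in `s`. -/
@[reducible] noncomputable def driverSigma (ξ α : ℕ → Ω → ℝ) (β : ℕ → Ω → ℕ) (s : Set (ℕ ⊕ ℕ ⊕ ℕ)) : MeasurableSpace Ω :=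
  ⨆ i ∈ s, MeasurableSpace.comap (driver ξ α β i) inferInstance

/-- The indices of the variables that determine the first `n` increments. -/
def pastIndex (n : ℕ) : Set (ℕ ⊕ ℕ ⊕ ℕ) :=
  {i | Sum.elim (fun j => j < n) (Sum.elim (fun j => j + 1 < n) (fun j => j + 1 < n)) i}

/-- The history of the walk up to time `n`. -/
@[reducible] noncomputable def history (ξ α : ℕ → Ω → ℝ) (β : ℕ → Ω → ℕ) (n : ℕ) : MeasurableSpace Ω :=
  driverSigma ξ α β (pastIndex n)

section Driver

variable {ξ α : ℕ → Ω → ℝ} {β : ℕ → Ω → ℕ}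

theorem driverSigma_mono {s t : Set (ℕ ⊕ ℕ ⊕ ℕ)} (h : s ⊆ t) :
    driverSigma ξ α β s ≤ driverSigma ξ α β t :=
  biSup_mono h

theorem measurable_driver {s : Set (ℕ ⊕ ℕ ⊕ ℕ)} {i : ℕ ⊕ ℕ ⊕ ℕ} (hi : i ∈ s) :
    Measurable[driverSigma ξ α β s] (driver ξ α β i) :=
  (comap_measurable _).mono
    (le_iSup₂ (f := fun i (_ : i ∈ s) => MeasurableSpace.comap (driver ξ α β i) inferInstance) i hi)
    le_rfl

theorem measurable_innovation_driver {s : Set (ℕ ⊕ ℕ ⊕ ℕ)} {n : ℕ} (hi : Sum.inl n ∈ s) :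
    Measurable[driverSigma ξ α β s] (ξ (n + 1)) := measurable_driver hi

theorem measurable_bernoulli_driver {s : Set (ℕ ⊕ ℕ ⊕ ℕ)} {n : ℕ}
    (hi : Sum.inr (Sum.inl n) ∈ s) : Measurable[driverSigma ξ α β s] (α (n + 2)) :=
  measurable_driver hi

theorem measurableSet_memory_driver {s : Set (ℕ ⊕ ℕ ⊕ ℕ)} {n : ℕ}
    (hi : Sum.inr (Sum.inr n) ∈ s) (k : ℕ) :
    MeasurableSet[driverSigma ξ α β s] {ω | β (n + 2) ω = k} := by
  have h := measurable_driver (ξ := ξ) (α := α) (β := β) hi (measurableSet_singleton (k : ℝ))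
  convert h using 1
  ext ω
  simp [driver]

/-- Splitting over the memory value replaces the random index by deterministic ones; the default
value 0 agrees with a sum in which no index matches. -/
theorem X_add_two (n : ℕ) (ω : Ω) :
    X ξ α β (n + 2) ω = ∑ k ∈ Finset.Icc 1 (n + 1), if β (n + 2) ω = k then
      α (n + 2) ω * X ξ α β k ω + (1 - α (n + 2) ω) * ξ (n + 2) ω else 0 := by
  rw [Finset.sum_ite_eq]
  simp only [X]
  rw [increment]
  by_cases h : 1 ≤ β (n + 2) ω ∧ β (n + 2) ω < n + 2
  · rw [dif_pos h, if_pos (Finset.mem_Icc.2 ⟨h.1, by omega⟩)]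
  · rw [dif_neg h, if_neg (fun h' => h ⟨(Finset.mem_Icc.1 h').1, by
      have := (Finset.mem_Icc.1 h').2; omega⟩)]

theorem measurable_X_history (n : ℕ) : Measurable[history ξ α β n] (X ξ α β n) := by
  induction n using Nat.strong_induction_on with
  | _ n ih =>
    match n with
    | 0 =>
      have : X ξ α β 0 = fun _ => 0 := by ext ω; simp [X, increment]
      rw [this]
      exact measurable_const
    | 1 =>
      have : X ξ α β 1 = ξ 1 := by ext ω; simp [X, increment]
      rw [this]
      exact measurable_innovation_driver (n := 0) (by simp [pastIndex])
    | n + 2 =>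
      have : X ξ α β (n + 2) = fun ω => ∑ k ∈ Finset.Icc 1 (n + 1), if β (n + 2) ω = k then
          α (n + 2) ω * X ξ α β k ω + (1 - α (n + 2) ω) * ξ (n + 2) ω else 0 :=
        funext (X_add_two n)
      rw [this]
      refine Finset.measurable_sum _ fun k hk => ?_
      have hk' := (Finset.mem_Icc.1 hk).2
      have hα : Measurable[history ξ α β (n + 2)] (α (n + 2)) :=
        measurable_bernoulli_driver (by simp [pastIndex])
      have hξ : Measurable[history ξ α β (n + 2)] (ξ (n + 2)) :=
        measurable_innovation_driver (n := n + 1) (by simp [pastIndex])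
      have hX : Measurable[history ξ α β (n + 2)] (X ξ α β k) :=
        (ih k (by omega)).mono (driverSigma_mono fun i hi => by
          rcases i with i | i | i <;> simp [pastIndex] at hi ⊢ <;> omega) le_rfl
      refine Measurable.ite (measurableSet_memory_driver (by simp [pastIndex]) k) ?_ measurable_const
      exact (hα.mul hX).add ((measurable_const.sub hα).mul hξ)

end Driver

/-- A process adapted to `ℱ` whose next value is, given the past, a fresh copy of the first value
with probability `1 - p` and a copy of the `k`-th value with probability `p * μ k / ν n`. -/
structure IsMemoryProcess [mΩ : MeasurableSpace Ω] (P : Measure Ω) (p : ℝ) (μ : ℕ → ℝ)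
    (Y : ℕ → Ω → ℝ) (ℱ : ℕ → MeasurableSpace Ω) : Prop where
  le : ∀ n, ℱ n ≤ mΩ
  mono : Monotone ℱ
  adapted : ∀ n, Measurable[ℱ n] (Y n)
  integral_step : ∀ n, 1 ≤ n → ∀ H : Ω → ℂ, Measurable[ℱ n] H → Integrable H P →
    ∀ g : ℝ → ℂ, Measurable g → Integrable (fun ω => g (Y 1 ω)) P →
    (∀ k ∈ Finset.Icc 1 n, Integrable (fun ω => H ω * g (Y k ω)) P) →
    Integrable (fun ω => H ω * g (Y (n + 1) ω)) P ∧
    ∫ ω, H ω * g (Y (n + 1) ω) ∂P = ∑ k ∈ Finset.Icc 1 n, ((μ k / nu μ n : ℝ) : ℂ) *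
      (p * ∫ ω, H ω * g (Y k ω) ∂P + (1 - p) * ((∫ ω, H ω ∂P) * ∫ ω, g (Y 1 ω) ∂P))

section Indep

variable {ξ α : ℕ → Ω → ℝ} {β : ℕ → Ω → ℕ} [mΩ : MeasurableSpace Ω] {P : Measure Ω}
  {p : ℝ} {μ : ℕ → ℝ}

theorem IsDriving.measurable_driver (h : IsDriving P p μ ξ α β) (i : ℕ ⊕ ℕ ⊕ ℕ) :
    Measurable (driver ξ α β i) := by
  rcases i with n | n | n
  · exact h.measurable_innovation (n + 1) (by omega)
  · exact h.measurable_bernoulli (n + 2) (by omega)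
  · exact (measurable_from_nat (f := fun m : ℕ => (m : ℝ))).comp (h.measurable_memory (n + 2) (by omega))

theorem IsDriving.driverSigma_le (h : IsDriving P p μ ξ α β) (s : Set (ℕ ⊕ ℕ ⊕ ℕ)) :
    driverSigma ξ α β s ≤ mΩ :=
  iSup₂_le fun i _ => (h.measurable_driver i).comap_le

theorem IsDriving.indepFun (h : IsDriving P p μ ξ α β) {s t : Set (ℕ ⊕ ℕ ⊕ ℕ)}
    (hst : Disjoint s t) {u w : Ω → ℂ} (hu : Measurable[driverSigma ξ α β s] u)
    (hw : Measurable[driverSigma ξ α β t] w) : IndepFun u w P := by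
  have hi := indep_iSup_of_disjoint (fun i => (h.measurable_driver i).comap_le)
    ((iIndepFun_iff_iIndep _ _ _).1 h.indep) hst
  rw [IndepFun_iff_Indep]
  exact indep_of_indep_of_le hi hu.comap_le hw.comap_le

theorem integral_ite_one_zero {s : Set Ω} [DecidablePred (· ∈ s)] (hs : MeasurableSet s) :
    ∫ ω, (if ω ∈ s then (1 : ℂ) else 0) ∂P = (P.real s : ℂ) := by
  have : (fun ω => if ω ∈ s then (1 : ℂ) else 0) = s.indicator (fun _ => 1) := by
    ext ω; simp [Set.indicator_apply]
  rw [this, integral_indicator_const _ hs]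
  simp

theorem integrable_ite_one_zero [IsFiniteMeasure P] {s : Set Ω} [DecidablePred (· ∈ s)]
    (hs : MeasurableSet s) : Integrable (fun ω => if ω ∈ s then (1 : ℂ) else 0) P := by
  refine Integrable.of_bound (Measurable.ite hs measurable_const measurable_const).aestronglyMeasurable
    1 (Eventually.of_forall fun ω => ?_)
  split_ifs <;> simp

/-- On the events `α = 0, 1` and `β = k` the new value is explicit, and the past, `α`, `β` and the
new innovation are independent, so every integral factors. Complex test functions let the same
identity serve moments and characteristic functions. -/
theorem IsDriving.isMemoryProcess [IsProbabilityMeasure P] (h : IsDriving P p μ ξ α β)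
    (hμ : ∀ n, 1 ≤ n → 0 < μ n) :
    IsMemoryProcess P p μ (X ξ α β) (history ξ α β) where
  le n := h.driverSigma_le _
  mono := by
    intro m n hmn
    refine driverSigma_mono fun i hi => ?_
    rcases i with i | i | i <;> simp [pastIndex] at hi ⊢ <;> omega
  adapted := measurable_X_history
  integral_step := by
    intro n hn H hH hHi g hg hg1 hgk
    obtain ⟨n, rfl⟩ := Nat.exists_eq_add_of_le' hn
    have hX1 : X ξ α β 1 = ξ 1 := by ext ω; simp [X, increment]
    set sα : Set (ℕ ⊕ ℕ ⊕ ℕ) := {Sum.inr (Sum.inl n)} with hsα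
    set sβ : Set (ℕ ⊕ ℕ ⊕ ℕ) := {Sum.inr (Sum.inr n)} with hsβ
    set sξ : Set (ℕ ⊕ ℕ ⊕ ℕ) := {Sum.inl (n + 1)} with hsξ
    let A : ℝ → Ω → ℂ := fun x ω => if ω ∈ {ω | α (n + 2) ω = x} then 1 else 0
    let B : ℕ → Ω → ℂ := fun k ω => if ω ∈ {ω | β (n + 2) ω = k} then 1 else 0
    have mA : ∀ x, Measurable[driverSigma ξ α β sα] (A x) := fun x =>
      Measurable.ite (measurable_bernoulli_driver (s := sα) (by simp [hsα])
        (measurableSet_singleton x)) measurable_const measurable_const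
    have mB : ∀ k, Measurable[driverSigma ξ α β sβ] (B k) := fun k =>
      Measurable.ite (measurableSet_memory_driver (by simp [hsβ]) k) measurable_const
        measurable_const
    have mξ : Measurable[driverSigma ξ α β sξ] (fun ω => g (ξ (n + 2) ω)) :=
      hg.comp (measurable_innovation_driver (n := n + 1) (by simp [hsξ]))
    have mX : ∀ k ∈ Finset.Icc 1 (n + 1), Measurable[history ξ α β (n + 1)] (X ξ α β k) := by
      intro k hk
      have := (Finset.mem_Icc.1 hk).2
      refine (measurable_X_history k).mono (driverSigma_mono fun i hi => ?_) le_rfl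
      rcases i with i | i | i <;> simp [pastIndex] at hi ⊢ <;> omega
    have sA : ∀ x, MeasurableSet {ω | α (n + 2) ω = x} := fun x =>
      h.measurable_bernoulli (n + 2) (by omega) (measurableSet_singleton x)
    have sB : ∀ k, MeasurableSet {ω | β (n + 2) ω = k} := fun k =>
      h.measurable_memory (n + 2) (by omega) (measurableSet_singleton k)
    have iA : ∀ x, Integrable (A x) P := fun x => integrable_ite_one_zero (sA x)
    have iB : ∀ k, Integrable (B k) P := fun k => integrable_ite_one_zero (sB k)
    have vA1 : ∫ ω, A 1 ω ∂P = p := by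
      rw [integral_ite_one_zero (sA 1), h.bernoulli_one (n + 2) (by omega)]
    have vA0 : ∫ ω, A 0 ω ∂P = 1 - p := by
      rw [integral_ite_one_zero (sA 0), h.bernoulli_zero (n + 2) (by omega)]; push_cast; rfl
    have vB : ∀ k ∈ Finset.Icc 1 (n + 1), ∫ ω, B k ω ∂P = ((μ k / nu μ (n + 1) : ℝ) : ℂ) := by
      intro k hk
      rw [integral_ite_one_zero (sB k), h.memory_law (n + 1) hn k hk]
    have id1 := h.identDistrib_innovation (n + 2) (by omega)
    have idg : IdentDistrib (fun ω => g (ξ (n + 2) ω)) (fun ω => g (ξ 1 ω)) P P := id1.comp hg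
    have iξ : Integrable (fun ω => g (ξ (n + 2) ω)) P := by
      rw [hX1] at hg1; exact idg.integrable_iff.2 hg1
    have vξ : ∫ ω, g (ξ (n + 2) ω) ∂P = ∫ ω, g (X ξ α β 1 ω) ∂P := by
      rw [hX1]; exact idg.integral_eq
    have aeA : ∀ᵐ ω ∂P, α (n + 2) ω = 1 ∨ α (n + 2) ω = 0 := by
      have hd : Disjoint {ω | α (n + 2) ω = 1} {ω | α (n + 2) ω = 0} := by
        rw [Set.disjoint_left]
        intro ω h1 h0
        simp only [Set.mem_ofPred_eq] at h1 h0
        linarith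
      have hm : P.real ({ω | α (n + 2) ω = 1} ∪ {ω | α (n + 2) ω = 0}) = 1 := by
        rw [measureReal_union hd (sA 0), h.bernoulli_one (n + 2) (by omega),
          h.bernoulli_zero (n + 2) (by omega)]
        ring
      have := (prob_compl_eq_zero_iff ((sA 1).union (sA 0))).2
        ((ENNReal.toReal_eq_one_iff _).1 hm)
      filter_upwards [compl_mem_ae_iff.2 this] with ω hω
      simpa [or_iff_not_imp_left] using hω
    have key : (fun ω => H ω * g (X ξ α β (n + 1 + 1) ω)) =ᵐ[P] fun ω =>
        ∑ k ∈ Finset.Icc 1 (n + 1), ((H ω * g (X ξ α β k ω)) * (A 1 ω * B k ω) +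
          H ω * ((A 0 ω * B k ω) * g (ξ (n + 2) ω))) := by
      -- The prescribed probabilities add up to 1, so the default branch of `increment` is a null
      -- event.
      have aeB : ∀ᵐ ω ∂P, β (n + 2) ω ∈ Finset.Icc 1 (n + 1) := by
        have hun : {ω | β (n + 2) ω ∈ Finset.Icc 1 (n + 1)} =
            ⋃ k ∈ Finset.Icc 1 (n + 1), {ω | β (n + 2) ω = k} := by ext ω; simp
        have hm : P.real {ω | β (n + 2) ω ∈ Finset.Icc 1 (n + 1)} = 1 := by
          rw [hun, measureReal_biUnion_finset (fun i _ j _ hij => by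
            rw [Function.onFun, Set.disjoint_left]
            intro ω h1 h2
            exact hij (h1.symm.trans h2)) fun k _ => sB k,
            Finset.sum_congr rfl (fun k hk => h.memory_law (n + 1) hn k hk), ← Finset.sum_div]
          exact div_self (nu_pos hμ hn).ne'
        have hms : MeasurableSet {ω | β (n + 2) ω ∈ Finset.Icc 1 (n + 1)} := by
          rw [hun]; exact Finset.measurableSet_biUnion _ fun k _ => sB k
        have := (prob_compl_eq_zero_iff hms).2 ((ENNReal.toReal_eq_one_iff _).1 hm)
        filter_upwards [compl_mem_ae_iff.2 this] with ω hω
        simpa using hω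
      filter_upwards [aeA, aeB] with ω hα hβ
      rw [X_add_two, Finset.sum_ite_eq, if_pos hβ, Finset.sum_eq_single (β (n + 2) ω)]
      · rcases hα with hα | hα <;> simp [A, B, hα]
      · intro k _ hk
        simp [B, Ne.symm hk]
      · intro h'; exact absurd hβ h'
    -- Joint independence is used through nested pairs of blocks: `α` and `β`, then both and `ξ`,
    -- then the past and all three.
    have hAB : Disjoint sα sβ := by simp [hsα, hsβ]
    have hABξ : Disjoint (sα ∪ sβ) sξ := by simp [hsα, hsβ, hsξ]
    have hp3 : Disjoint (pastIndex (n + 1)) (sα ∪ sβ ∪ sξ) := by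
      simp [hsα, hsβ, hsξ, pastIndex]
    have mAB : ∀ x k, Measurable[driverSigma ξ α β (sα ∪ sβ)] (fun ω => A x ω * B k ω) :=
      fun x k => ((mA x).mono (driverSigma_mono Set.subset_union_left) le_rfl).mul
        ((mB k).mono (driverSigma_mono Set.subset_union_right) le_rfl)
    have mAB' : ∀ x k, Measurable[driverSigma ξ α β (sα ∪ sβ ∪ sξ)] (fun ω => A x ω * B k ω) :=
      fun x k => (mAB x k).mono (driverSigma_mono Set.subset_union_left) le_rfl
    have mABξ : ∀ x k, Measurable[driverSigma ξ α β (sα ∪ sβ ∪ sξ)]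
        (fun ω => (A x ω * B k ω) * g (ξ (n + 2) ω)) := fun x k =>
      (mAB' x k).mul (mξ.mono (driverSigma_mono Set.subset_union_right) le_rfl)
    have iAB : ∀ x k, Integrable (fun ω => A x ω * B k ω) P := fun x k =>
      (h.indepFun hAB (mA x) (mB k)).integrable_mul (iA x) (iB k)
    have vAB : ∀ x k, ∫ ω, A x ω * B k ω ∂P = (∫ ω, A x ω ∂P) * ∫ ω, B k ω ∂P := fun x k =>
      (h.indepFun hAB (mA x) (mB k)).integral_fun_mul_eq_mul_integral (iA x).1 (iB k).1
    have iABξ : ∀ x k, Integrable (fun ω => (A x ω * B k ω) * g (ξ (n + 2) ω)) P := fun x k =>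
      (h.indepFun hABξ (mAB x k) mξ).integrable_mul (iAB x k) iξ
    have vABξ : ∀ x k, ∫ ω, (A x ω * B k ω) * g (ξ (n + 2) ω) ∂P =
        (∫ ω, A x ω * B k ω ∂P) * ∫ ω, g (ξ (n + 2) ω) ∂P := fun x k =>
      (h.indepFun hABξ (mAB x k) mξ).integral_fun_mul_eq_mul_integral (iAB x k).1 iξ.1
    have mHg : ∀ k ∈ Finset.Icc 1 (n + 1), Measurable[history ξ α β (n + 1)]
        (fun ω => H ω * g (X ξ α β k ω)) := fun k hk => hH.mul (hg.comp (mX k hk))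
    have i1 : ∀ k ∈ Finset.Icc 1 (n + 1),
        Integrable (fun ω => (H ω * g (X ξ α β k ω)) * (A 1 ω * B k ω)) P := fun k hk =>
      (h.indepFun hp3 (mHg k hk) (mAB' 1 k)).integrable_mul (hgk k hk) (iAB 1 k)
    have i2 : ∀ k, Integrable (fun ω => H ω * ((A 0 ω * B k ω) * g (ξ (n + 2) ω))) P := fun k =>
      (h.indepFun hp3 hH (mABξ 0 k)).integrable_mul hHi (iABξ 0 k)
    have i12 : ∀ k ∈ Finset.Icc 1 (n + 1), Integrable (fun ω =>
        (H ω * g (X ξ α β k ω)) * (A 1 ω * B k ω) +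
          H ω * ((A 0 ω * B k ω) * g (ξ (n + 2) ω))) P := fun k hk => (i1 k hk).add (i2 k)
    refine ⟨(integrable_finsetSum _ i12).congr key.symm, ?_⟩
    rw [integral_congr_ae key, integral_finsetSum _ i12]
    refine Finset.sum_congr rfl fun k hk => ?_
    rw [integral_add (i1 k hk) (i2 k),
      (h.indepFun hp3 (mHg k hk) (mAB' 1 k)).integral_fun_mul_eq_mul_integral (hgk k hk).1 (iAB 1 k).1,
      (h.indepFun hp3 hH (mABξ 0 k)).integral_fun_mul_eq_mul_integral hHi.1 (iABξ 0 k).1,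
      vABξ, vAB, vAB, vA1, vA0, vB k hk, vξ]
    ring

end Indep

/-! ### The martingale of weighted sums and its second moments. -/

/-- The weighted sum `∑_{k=1}^n μ k * f (Y k)`. -/
noncomputable def weightedSum (μ : ℕ → ℝ) (Y : ℕ → Ω → ℝ) (f : ℝ → ℝ) (n : ℕ) (ω : Ω) : ℝ :=
  ∑ k ∈ Finset.Icc 1 n, μ k * f (Y k ω)

/-- The difference of `f (Y n)` and its conditional expectation given the past. -/
noncomputable def innov (p : ℝ) (μ : ℕ → ℝ) (Y : ℕ → Ω → ℝ) (f : ℝ → ℝ) (n : ℕ) (ω : Ω) : ℝ :=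
  f (Y n ω) - p / nu μ (n - 1) * weightedSum μ Y f (n - 1) ω

theorem weightedSum_succ (μ : ℕ → ℝ) (Y : ℕ → Ω → ℝ) (f : ℝ → ℝ) (n : ℕ) (ω : Ω) :
    weightedSum μ Y f (n + 1) ω = weightedSum μ Y f n ω + μ (n + 1) * f (Y (n + 1) ω) := by
  rw [weightedSum, weightedSum, Finset.sum_Icc_succ_top (by omega)]

theorem weightedSum_zero (μ : ℕ → ℝ) (Y : ℕ → Ω → ℝ) (f : ℝ → ℝ) (ω : Ω) :
    weightedSum μ Y f 0 ω = 0 := by simp [weightedSum]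

theorem innov_one (p : ℝ) (μ : ℕ → ℝ) (Y : ℕ → Ω → ℝ) (f : ℝ → ℝ) (ω : Ω) :
    innov p μ Y f 1 ω = f (Y 1 ω) := by simp [innov, weightedSum]

theorem innov_succ (p : ℝ) (μ : ℕ → ℝ) (Y : ℕ → Ω → ℝ) (f : ℝ → ℝ) (n : ℕ) (ω : Ω) :
    innov p μ Y f (n + 1) ω = f (Y (n + 1) ω) - p / nu μ n * weightedSum μ Y f n ω := rfl

/-- The factor `1 + p μ (n+1) / ν n` relating `a n` to `a (n+1)` is the mean growth of the weighted
sum, so only the innovations remain. -/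
theorem a_mul_weightedSum {μ : ℕ → ℝ} {p : ℝ} (hμ : ∀ n, 1 ≤ n → 0 < μ n) (hp : 0 ≤ p)
    (Y : ℕ → Ω → ℝ) (f : ℝ → ℝ) (n : ℕ) (ω : Ω) :
    a p μ n * weightedSum μ Y f n ω =
      ∑ j ∈ Finset.Icc 1 n, a p μ j * μ j * innov p μ Y f j ω := by
  induction n with
  | zero => simp [weightedSum]
  | succ n ih =>
    rw [Finset.sum_Icc_succ_top (by omega), ← ih]
    rcases Nat.eq_zero_or_pos n with rfl | hn
    · rw [weightedSum_succ, innov_one, weightedSum_zero]; ring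
    · rw [weightedSum_succ, innov_succ, a_eq_mul_succ hμ hp hn]; ring

theorem sum_div_nu {μ : ℕ → ℝ} (hμ : ∀ n, 1 ≤ n → 0 < μ n) {n : ℕ} (hn : 1 ≤ n) :
    ∑ k ∈ Finset.Icc 1 n, μ k / nu μ n = 1 := by
  rw [← Finset.sum_div]; exact div_self (nu_pos hμ hn).ne'

/-- Truncation at `K`: a bounded part, to be centred by `m`, and a nonnegative excess. -/
theorem weightedSum_sq_div_sub_one {μ : ℕ → ℝ} {Y : ℕ → Ω → ℝ} (hμ : ∀ n, 1 ≤ n → 0 < μ n) (K m : ℝ) {n : ℕ} (hn : 1 ≤ n)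
    (ω : Ω) :
    weightedSum μ Y (fun x => x ^ 2) n ω / nu μ n - 1 =
      weightedSum μ Y (fun x => min (x ^ 2) K - m) n ω / nu μ n +
        (∑ k ∈ Finset.Icc 1 n, μ k / nu μ n * (Y k ω ^ 2 - min (Y k ω ^ 2) K) - (1 - m)) := by
  have hν := (nu_pos hμ hn).ne'
  have h1 := sum_div_nu hμ hn
  have e : ∑ k ∈ Finset.Icc 1 n, μ k / nu μ n * (Y k ω ^ 2 - min (Y k ω ^ 2) K) =
      weightedSum μ Y (fun x => x ^ 2) n ω / nu μ n -
        weightedSum μ Y (fun x => min (x ^ 2) K - m) n ω / nu μ n -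
          m * ∑ k ∈ Finset.Icc 1 n, μ k / nu μ n := by
    rw [weightedSum, weightedSum, Finset.sum_div, Finset.sum_div, Finset.mul_sum,
      ← Finset.sum_sub_distrib, ← Finset.sum_sub_distrib]
    refine Finset.sum_congr rfl fun k _ => ?_
    ring
  rw [e, h1]
  ring

theorem integral_abs_le_sqrt [MeasurableSpace Ω] {P : Measure Ω} [IsProbabilityMeasure P]
    {U : Ω → ℝ} (hU : MemLp U 2 P) : ∫ ω, |U ω| ∂P ≤ Real.sqrt (∫ ω, U ω ^ 2 ∂P) := by
  have h1 := variance_nonneg (fun ω => |U ω|) P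
  rw [variance_eq_sub (X := fun ω => |U ω|) hU.abs] at h1
  refine Real.le_sqrt_of_sq_le ?_
  have : ∫ ω, ((fun ω => |U ω|) ^ 2) ω ∂P = ∫ ω, U ω ^ 2 ∂P :=
    integral_congr_ae (Eventually.of_forall fun ω => by simp)
  linarith

namespace IsMemoryProcess

variable [mΩ : MeasurableSpace Ω] {P : Measure Ω} {p : ℝ} {μ : ℕ → ℝ}
  {Y : ℕ → Ω → ℝ} {ℱ : ℕ → MeasurableSpace Ω}

theorem measurable (h : IsMemoryProcess P p μ Y ℱ) (n : ℕ) : Measurable (Y n) :=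
  (h.adapted n).mono (h.le n) le_rfl

theorem adapted_le (h : IsMemoryProcess P p μ Y ℱ) {k n : ℕ} (hkn : k ≤ n) :
    Measurable[ℱ n] (Y k) :=
  (h.adapted k).mono (h.mono hkn) le_rfl

theorem integral_step_real (h : IsMemoryProcess P p μ Y ℱ) {n : ℕ} (hn : 1 ≤ n) {H : Ω → ℝ}
    (hH : Measurable[ℱ n] H) (hHi : Integrable H P) {g : ℝ → ℝ} (hg : Measurable g)
    (hg1 : Integrable (fun ω => g (Y 1 ω)) P)
    (hgk : ∀ k ∈ Finset.Icc 1 n, Integrable (fun ω => H ω * g (Y k ω)) P) :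
    Integrable (fun ω => H ω * g (Y (n + 1) ω)) P ∧
    ∫ ω, H ω * g (Y (n + 1) ω) ∂P = ∑ k ∈ Finset.Icc 1 n, (μ k / nu μ n) *
      (p * ∫ ω, H ω * g (Y k ω) ∂P + (1 - p) * ((∫ ω, H ω ∂P) * ∫ ω, g (Y 1 ω) ∂P)) := by
  obtain ⟨h1, h2⟩ := h.integral_step n hn (fun ω => (H ω : ℂ))
    (Complex.measurable_ofReal.comp hH) hHi.ofReal (fun x => (g x : ℂ))
    (Complex.measurable_ofReal.comp hg) hg1.ofReal (fun k hk => by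
      simpa using (hgk k hk).ofReal (𝕜 := ℂ))
  constructor
  · simpa using h1.re
  · simp only [← Complex.ofReal_mul, integral_complex_ofReal] at h2
    exact_mod_cast h2

theorem measurable_weightedSum (h : IsMemoryProcess P p μ Y ℱ) {f : ℝ → ℝ} (hf : Measurable f) (n : ℕ) :
    Measurable[ℱ n] (weightedSum μ Y f n) :=
  Finset.measurable_sum _ fun _ hk =>
    measurable_const.mul (hf.comp (h.adapted_le (Finset.mem_Icc.1 hk).2))

theorem measurable_innov (h : IsMemoryProcess P p μ Y ℱ) {f : ℝ → ℝ} (hf : Measurable f) (n : ℕ) :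
    Measurable[ℱ n] (innov p μ Y f n) :=
  (hf.comp (h.adapted n)).sub
    (measurable_const.mul ((h.measurable_weightedSum hf (n - 1)).mono (h.mono (Nat.sub_le _ _)) le_rfl))

theorem tendsto_integral_min_sq (h : IsMemoryProcess P p μ Y ℱ)
    (h2 : Integrable (fun ω => Y 1 ω ^ 2) P) :
    Tendsto (fun K : ℕ => ∫ ω, min (Y 1 ω ^ 2) (K : ℝ) ∂P) atTop (𝓝 (∫ ω, Y 1 ω ^ 2 ∂P)) := by
  refine tendsto_integral_of_dominated_convergence (fun ω => Y 1 ω ^ 2)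
    (fun K => (((h.measurable 1).pow_const 2).min measurable_const).aestronglyMeasurable) h2 ?_ ?_
  · refine fun K => Eventually.of_forall fun ω => ?_
    rw [Real.norm_of_nonneg (le_min (sq_nonneg _) (Nat.cast_nonneg K))]
    exact min_le_left _ _
  · refine Eventually.of_forall fun ω => tendsto_const_nhds.congr' ?_
    filter_upwards [tendsto_natCast_atTop_atTop.eventually_ge_atTop (Y 1 ω ^ 2)] with K hK
    rw [min_eq_left hK]

variable [IsProbabilityMeasure P]

/-- Each new value is drawn from a mixture of laws that all equal that of `Y 1`, so strong induction
with `H = 1` applies. -/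
theorem integral_comp (h : IsMemoryProcess P p μ Y ℱ) (hμ : ∀ n, 1 ≤ n → 0 < μ n) {g : ℝ → ℝ}
    (hg : Measurable g) (hg1 : Integrable (fun ω => g (Y 1 ω)) P) {n : ℕ} (hn : 1 ≤ n) :
    Integrable (fun ω => g (Y n ω)) P ∧ ∫ ω, g (Y n ω) ∂P = ∫ ω, g (Y 1 ω) ∂P := by
  induction n using Nat.strong_induction_on with
  | _ n ih =>
    rcases Nat.lt_or_ge 1 n with h1 | h1
    · obtain ⟨n, rfl⟩ := Nat.exists_eq_add_of_lt h1
      have := h.integral_step_real (n := 1 + n) (by omega) (H := fun _ => 1) measurable_const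
        (integrable_const _) hg hg1 (fun k hk => by
          simpa using (ih k (by have := (Finset.mem_Icc.1 hk).2; omega) (Finset.mem_Icc.1 hk).1).1)
      simp only [one_mul, integral_const, probReal_univ, smul_eq_mul] at this
      refine ⟨this.1, this.2.trans ?_⟩
      rw [Finset.sum_congr rfl fun k hk => by
        rw [(ih k (by have := (Finset.mem_Icc.1 hk).2; omega) (Finset.mem_Icc.1 hk).1).2],
        ← Finset.sum_mul, sum_div_nu hμ (by omega)]
      ring
    · obtain rfl : n = 1 := by omega
      exact ⟨hg1, rfl⟩

variable {f : ℝ → ℝ}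

theorem memLp_comp (h : IsMemoryProcess P p μ Y ℱ) (hμ : ∀ n, 1 ≤ n → 0 < μ n)
    (hf : Measurable f) (hf2 : Integrable (fun ω => f (Y 1 ω) ^ 2) P) {n : ℕ} (hn : 1 ≤ n) :
    MemLp (fun ω => f (Y n ω)) 2 P :=
  (memLp_two_iff_integrable_sq (hf.comp (h.measurable n)).aestronglyMeasurable).2
    (h.integral_comp hμ (hf.pow_const 2) hf2 hn).1

theorem memLp_weightedSum (h : IsMemoryProcess P p μ Y ℱ) (hμ : ∀ n, 1 ≤ n → 0 < μ n)
    (hf : Measurable f) (hf2 : Integrable (fun ω => f (Y 1 ω) ^ 2) P) (n : ℕ) :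
    MemLp (weightedSum μ Y f n) 2 P :=
  memLp_finsetSum _ fun _ hk => (h.memLp_comp hμ hf hf2 (Finset.mem_Icc.1 hk).1).const_mul _

theorem memLp_innov (h : IsMemoryProcess P p μ Y ℱ) (hμ : ∀ n, 1 ≤ n → 0 < μ n)
    (hf : Measurable f) (hf2 : Integrable (fun ω => f (Y 1 ω) ^ 2) P) {n : ℕ} (hn : 1 ≤ n) :
    MemLp (innov p μ Y f n) 2 P :=
  (h.memLp_comp hμ hf hf2 hn).sub ((h.memLp_weightedSum hμ hf hf2 _).const_mul _)

/-- The innovation subtracts precisely the conditional mean coming from the memory; the fresh-copy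
part vanishes by centring. -/
theorem integral_mul_innov (h : IsMemoryProcess P p μ Y ℱ) (hμ : ∀ n, 1 ≤ n → 0 < μ n)
    (hf : Measurable f) (hf2 : Integrable (fun ω => f (Y 1 ω) ^ 2) P)
    (hf0 : ∫ ω, f (Y 1 ω) ∂P = 0) {n : ℕ} (hn : 1 ≤ n) {H : Ω → ℝ} (hH : Measurable[ℱ n] H)
    (hH2 : MemLp H 2 P) : ∫ ω, H ω * innov p μ Y f (n + 1) ω ∂P = 0 := by
  have hfi : ∀ k ∈ Finset.Icc 1 n, Integrable (fun ω => H ω * f (Y k ω)) P := fun k hk =>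
    hH2.integrable_mul (h.memLp_comp hμ hf hf2 (Finset.mem_Icc.1 hk).1)
  obtain ⟨h1, h2⟩ := h.integral_step_real hn hH (hH2.integrable one_le_two) hf
    ((h.memLp_comp hμ hf hf2 le_rfl).integrable one_le_two) hfi
  have e : ∀ ω, H ω * innov p μ Y f (n + 1) ω = H ω * f (Y (n + 1) ω) -
      ∑ k ∈ Finset.Icc 1 n, p * (μ k / nu μ n) * (H ω * f (Y k ω)) := by
    intro ω
    rw [innov_succ, weightedSum, mul_sub, Finset.mul_sum, Finset.mul_sum]
    congr 1
    refine Finset.sum_congr rfl fun k _ => ?_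
    ring
  simp only [e]
  rw [integral_sub h1 (integrable_finsetSum _ fun k hk => (hfi k hk).const_mul _), h2,
    integral_finsetSum _ fun k hk => (hfi k hk).const_mul _, hf0, ← Finset.sum_sub_distrib]
  refine Finset.sum_eq_zero fun k _ => ?_
  rw [integral_const_mul]
  ring

/-- Pythagoras: `f (Y n)` is the innovation plus an orthogonal function of the past, and all `Y n`
have the same law. -/
theorem integral_innov_sq_le (h : IsMemoryProcess P p μ Y ℱ) (hμ : ∀ n, 1 ≤ n → 0 < μ n)
    (hf : Measurable f) (hf2 : Integrable (fun ω => f (Y 1 ω) ^ 2) P)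
    (hf0 : ∫ ω, f (Y 1 ω) ∂P = 0) {n : ℕ} (hn : 1 ≤ n) :
    ∫ ω, innov p μ Y f n ω ^ 2 ∂P ≤ ∫ ω, f (Y 1 ω) ^ 2 ∂P := by
  rcases Nat.lt_or_ge 1 n with h1 | h1
  · obtain ⟨n, rfl⟩ := Nat.exists_eq_add_of_lt h1
    set m := 1 + n with hm
    set C : Ω → ℝ := fun ω => p / nu μ m * weightedSum μ Y f m ω with hC
    have mC : MemLp C 2 P := (h.memLp_weightedSum hμ hf hf2 _).const_mul _
    have mD := h.memLp_innov hμ hf hf2 (n := m + 1) (by omega)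
    have orth := h.integral_mul_innov hμ hf hf2 hf0 (n := m) (by omega)
      (H := C) (measurable_const.mul (h.measurable_weightedSum hf m)) mC
    rw [← (h.integral_comp hμ (hf.pow_const 2) hf2 (n := m + 1) (by omega)).2]
    have e : ∀ ω, f (Y (m + 1) ω) ^ 2 = innov p μ Y f (m + 1) ω ^ 2 +
        (2 * (C ω * innov p μ Y f (m + 1) ω) + C ω ^ 2) := by
      intro ω; rw [innov_succ]; simp only [hC]; ring
    simp only [e]
    have i1 : Integrable (fun ω => C ω * innov p μ Y f (m + 1) ω) P := mC.integrable_mul mD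
    have i2 : Integrable (fun ω => 2 * (C ω * innov p μ Y f (m + 1) ω) + C ω ^ 2) P :=
      (i1.const_mul 2).add mC.integrable_sq
    rw [integral_add mD.integrable_sq i2,
      integral_add (i1.const_mul 2) mC.integrable_sq, integral_const_mul]
    have : 0 ≤ ∫ ω, C ω ^ 2 ∂P := integral_nonneg fun ω => sq_nonneg _
    linarith
  · obtain rfl : n = 1 := by omega
    simp only [innov_one]
    exact le_rfl

theorem memLp_sum_innov (h : IsMemoryProcess P p μ Y ℱ) (hμ : ∀ n, 1 ≤ n → 0 < μ n)
    (hf : Measurable f) (hf2 : Integrable (fun ω => f (Y 1 ω) ^ 2) P) (w : ℕ → ℝ) (n : ℕ) :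
    MemLp (fun ω => ∑ j ∈ Finset.Icc 1 n, w j * innov p μ Y f j ω) 2 P :=
  memLp_finsetSum _ fun _ hk => (h.memLp_innov hμ hf hf2 (Finset.mem_Icc.1 hk).1).const_mul _

theorem integral_sum_innov_sq_le (h : IsMemoryProcess P p μ Y ℱ) (hμ : ∀ n, 1 ≤ n → 0 < μ n)
    (hf : Measurable f) (hf2 : Integrable (fun ω => f (Y 1 ω) ^ 2) P)
    (hf0 : ∫ ω, f (Y 1 ω) ∂P = 0) (w : ℕ → ℝ) (n : ℕ) :
    ∫ ω, (∑ j ∈ Finset.Icc 1 n, w j * innov p μ Y f j ω) ^ 2 ∂P ≤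
      (∑ j ∈ Finset.Icc 1 n, w j ^ 2) * ∫ ω, f (Y 1 ω) ^ 2 ∂P := by
  induction n with
  | zero => simp
  | succ n ih =>
    set T : Ω → ℝ := fun ω => ∑ j ∈ Finset.Icc 1 n, w j * innov p μ Y f j ω with hT
    have mT : MemLp T 2 P := h.memLp_sum_innov hμ hf hf2 w n
    have mD := h.memLp_innov hμ hf hf2 (n := n + 1) (by omega)
    have orth : ∫ ω, T ω * innov p μ Y f (n + 1) ω ∂P = 0 := by
      rcases Nat.eq_zero_or_pos n with rfl | hn
      · simp [hT]
      · refine h.integral_mul_innov hμ hf hf2 hf0 hn ?_ mT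
        exact Finset.measurable_sum _ fun k hk => measurable_const.mul
          ((h.measurable_innov hf k).mono (h.mono (Finset.mem_Icc.1 hk).2) le_rfl)
    have e : ∀ ω, (∑ j ∈ Finset.Icc 1 (n + 1), w j * innov p μ Y f j ω) ^ 2 =
        T ω ^ 2 + (2 * w (n + 1) * (T ω * innov p μ Y f (n + 1) ω) +
          w (n + 1) ^ 2 * innov p μ Y f (n + 1) ω ^ 2) := by
      intro ω; rw [Finset.sum_Icc_succ_top (by omega)]; simp only [hT]; ring
    simp only [e]
    have i1 : Integrable (fun ω => T ω * innov p μ Y f (n + 1) ω) P := mT.integrable_mul mD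
    have i2 : Integrable (fun ω => 2 * w (n + 1) * (T ω * innov p μ Y f (n + 1) ω) +
        w (n + 1) ^ 2 * innov p μ Y f (n + 1) ω ^ 2) P :=
      (i1.const_mul _).add (mD.integrable_sq.const_mul _)
    rw [integral_add mT.integrable_sq i2,
      integral_add (i1.const_mul _) (mD.integrable_sq.const_mul _), integral_const_mul,
      integral_const_mul, orth, Finset.sum_Icc_succ_top (by omega), add_mul]
    have := h.integral_innov_sq_le hμ hf hf2 hf0 (n := n + 1) (by omega)
    have := mul_le_mul_of_nonneg_left this (sq_nonneg (w (n + 1)))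
    linarith

theorem integral_a_mul_weightedSum_sq_le (h : IsMemoryProcess P p μ Y ℱ)
    (hμ : ∀ n, 1 ≤ n → 0 < μ n) (hp : 0 ≤ p)
    (hf : Measurable f) (hf2 : Integrable (fun ω => f (Y 1 ω) ^ 2) P)
    (hf0 : ∫ ω, f (Y 1 ω) ∂P = 0) (n : ℕ) :
    ∫ ω, (a p μ n * weightedSum μ Y f n ω) ^ 2 ∂P ≤ v p μ n ^ 2 * ∫ ω, f (Y 1 ω) ^ 2 ∂P := by
  simp only [a_mul_weightedSum hμ hp]
  refine (h.integral_sum_innov_sq_le hμ hf hf2 hf0 _ n).trans (le_of_eq ?_)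
  rw [v_sq, sum_Icc_one_eq_sum_range]

theorem integral_weightedSum_div_sq_le (h : IsMemoryProcess P p μ Y ℱ)
    (hμ : ∀ n, 1 ≤ n → 0 < μ n) (hp : 0 ≤ p)
    (hf : Measurable f) (hf2 : Integrable (fun ω => f (Y 1 ω) ^ 2) P)
    (hf0 : ∫ ω, f (Y 1 ω) ∂P = 0) (n : ℕ) :
    ∫ ω, (weightedSum μ Y f n ω / nu μ n) ^ 2 ∂P ≤
      v p μ n ^ 2 / (a p μ n * nu μ n) ^ 2 * ∫ ω, f (Y 1 ω) ^ 2 ∂P := by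
  have ha := a_pos hμ hp n
  have e : ∀ ω, (weightedSum μ Y f n ω / nu μ n) ^ 2 =
      ((a p μ n * nu μ n) ^ 2)⁻¹ * (a p μ n * weightedSum μ Y f n ω) ^ 2 := by
    intro ω; field_simp
  simp only [e]
  rw [integral_const_mul, div_eq_inv_mul, mul_assoc]
  exact mul_le_mul_of_nonneg_left (h.integral_a_mul_weightedSum_sq_le hμ hp hf hf2 hf0 n)
    (by positivity)

/-- The weighted averages of the squares converge in mean to the variance. -/
theorem tendsto_integral_abs_weightedSum_sq (h : IsMemoryProcess P p μ Y ℱ)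
    (hμ : ∀ n, 1 ≤ n → 0 < μ n) (hp : 0 ≤ p)
    (h2 : Integrable (fun ω => Y 1 ω ^ 2) P) (h1 : ∫ ω, Y 1 ω ^ 2 ∂P = 1)
    (hκ : Tendsto (fun n => v p μ n ^ 2 / (a p μ n * nu μ n) ^ 2) atTop (𝓝 0)) :
    Tendsto (fun n => ∫ ω, |weightedSum μ Y (fun x => x ^ 2) n ω / nu μ n - 1| ∂P) atTop
      (𝓝 0) := by
  rw [Metric.tendsto_atTop']
  intro ε hε
  have hK := h.tendsto_integral_min_sq h2
  rw [h1] at hK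
  -- Fourth moments are not assumed, so the `L²` bound is applied to the truncated squares; the
  -- excess above `K` has mean below `ε / 4` and is counted twice.
  obtain ⟨K, hK⟩ := (hK.eventually (eventually_gt_nhds (show 1 - ε / 4 < 1 by linarith))).exists
  set m : ℝ := ∫ ω, min (Y 1 ω ^ 2) (K : ℝ) ∂P with hm
  set f : ℝ → ℝ := fun x => min (x ^ 2) (K : ℝ) - m with hf
  have mf0 : Measurable fun x : ℝ => min (x ^ 2) (K : ℝ) :=
    (measurable_id.pow_const 2).min measurable_const
  have mf : Measurable f := mf0.sub measurable_const
  have imin : Integrable (fun ω => min (Y 1 ω ^ 2) (K : ℝ)) P := by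
    refine h2.mono (mf0.comp (h.measurable 1)).aestronglyMeasurable (Eventually.of_forall fun ω => ?_)
    rw [Real.norm_of_nonneg (le_min (sq_nonneg _) (Nat.cast_nonneg K)),
      Real.norm_of_nonneg (sq_nonneg _)]
    exact min_le_left _ _
  have hm0 : 0 ≤ m := integral_nonneg fun ω => le_min (sq_nonneg _) (Nat.cast_nonneg K)
  have hf2 : Integrable (fun ω => f (Y 1 ω) ^ 2) P := by
    refine Integrable.of_bound ((mf.comp (h.measurable 1)).pow_const 2).aestronglyMeasurable
      ((K + m) ^ 2) (Eventually.of_forall fun ω => ?_)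
    rw [Real.norm_of_nonneg (sq_nonneg _)]
    refine sq_le_sq' ?_ ?_
    · have : 0 ≤ min (Y 1 ω ^ 2) (K : ℝ) := le_min (sq_nonneg _) (Nat.cast_nonneg K)
      have : (0 : ℝ) ≤ K := Nat.cast_nonneg K
      simp only [hf]; linarith
    · have : min (Y 1 ω ^ 2) (K : ℝ) ≤ K := min_le_right _ _
      simp only [hf]; linarith
  have hf0 : ∫ ω, f (Y 1 ω) ∂P = 0 := by
    simp only [hf]
    rw [integral_sub imin (integrable_const _)]
    simp [hm]
  have hlim : Tendsto (fun n => Real.sqrt (v p μ n ^ 2 / (a p μ n * nu μ n) ^ 2 *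
      ∫ ω, f (Y 1 ω) ^ 2 ∂P)) atTop (𝓝 0) := by
    have := (hκ.mul_const (∫ ω, f (Y 1 ω) ^ 2 ∂P)).sqrt
    simpa using this
  obtain ⟨N, hN⟩ := eventually_atTop.1
    (hlim.eventually (eventually_lt_nhds (show 0 < ε / 2 by linarith)))
  refine ⟨max N 1, fun n hn => ?_⟩
  have hn1 : 1 ≤ n := (le_max_right N 1).trans hn.le
  rw [Real.dist_eq, sub_zero, abs_of_nonneg (integral_nonneg fun ω => abs_nonneg _)]
  set R : ℕ → Ω → ℝ := fun k ω => μ k / nu μ n * (Y k ω ^ 2 - min (Y k ω ^ 2) (K : ℝ)) with hR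
  have iYk : ∀ k, 1 ≤ k → Integrable (fun ω => Y k ω ^ 2 - min (Y k ω ^ 2) (K : ℝ)) P ∧
      ∫ ω, (Y k ω ^ 2 - min (Y k ω ^ 2) (K : ℝ)) ∂P = 1 - m := by
    intro k hk
    obtain ⟨u1, u2⟩ := h.integral_comp hμ (g := fun x => x ^ 2 - min (x ^ 2) (K : ℝ))
      ((measurable_id.pow_const 2).sub mf0) (h2.sub imin) hk
    refine ⟨u1, u2.trans ?_⟩
    rw [integral_sub h2 imin, h1]
  have iR : ∀ k ∈ Finset.Icc 1 n, Integrable (R k) P := fun k hk =>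
    (iYk k (Finset.mem_Icc.1 hk).1).1.const_mul _
  have iRs : Integrable (fun ω => ∑ k ∈ Finset.Icc 1 n, R k ω) P := integrable_finsetSum _ iR
  have vR : ∫ ω, ∑ k ∈ Finset.Icc 1 n, R k ω ∂P = 1 - m := by
    rw [integral_finsetSum _ iR]
    have : ∀ k ∈ Finset.Icc 1 n, ∫ ω, R k ω ∂P = μ k / nu μ n * (1 - m) := fun k hk => by
      rw [integral_const_mul, (iYk k (Finset.mem_Icc.1 hk).1).2]
    rw [Finset.sum_congr rfl this, ← Finset.sum_mul, sum_div_nu hμ hn1, one_mul]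
  have hm1 : 0 ≤ 1 - m := by
    rw [← (iYk 1 le_rfl).2]
    exact integral_nonneg fun ω => sub_nonneg.2 (min_le_left _ _)
  have mW : MemLp (fun ω => weightedSum μ Y f n ω / nu μ n) 2 P := by
    simp only [div_eq_mul_inv]
    exact (h.memLp_weightedSum hμ mf hf2 n).mul_const _
  have iW : Integrable (fun ω => |weightedSum μ Y f n ω / nu μ n|) P :=
    (mW.integrable one_le_two).abs
  have hb : ∀ ω, |weightedSum μ Y (fun x => x ^ 2) n ω / nu μ n - 1| ≤
      |weightedSum μ Y f n ω / nu μ n| + (∑ k ∈ Finset.Icc 1 n, R k ω + (1 - m)) := by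
    intro ω
    rw [weightedSum_sq_div_sub_one hμ K m hn1 ω]
    refine (abs_add_le _ _).trans (add_le_add le_rfl ?_)
    have hs : 0 ≤ ∑ k ∈ Finset.Icc 1 n, R k ω := Finset.sum_nonneg fun k hk => by
      have := hμ k (Finset.mem_Icc.1 hk).1
      have := nu_pos hμ hn1
      exact mul_nonneg (by positivity) (sub_nonneg.2 (min_le_left _ _))
    rw [abs_le]
    constructor <;> linarith
  have iRm : Integrable (fun ω => ∑ k ∈ Finset.Icc 1 n, R k ω + (1 - m)) P :=
    iRs.add (integrable_const _)
  calc ∫ ω, |weightedSum μ Y (fun x => x ^ 2) n ω / nu μ n - 1| ∂P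
      ≤ ∫ ω, (|weightedSum μ Y f n ω / nu μ n| + (∑ k ∈ Finset.Icc 1 n, R k ω + (1 - m))) ∂P :=
        integral_mono_of_nonneg (Eventually.of_forall fun ω => abs_nonneg _)
          (iW.add iRm) (Eventually.of_forall hb)
    _ = ∫ ω, |weightedSum μ Y f n ω / nu μ n| ∂P + 2 * (1 - m) := by
        rw [integral_add iW iRm, integral_add iRs (integrable_const _), vR]
        simp; ring
    _ ≤ Real.sqrt (v p μ n ^ 2 / (a p μ n * nu μ n) ^ 2 * ∫ ω, f (Y 1 ω) ^ 2 ∂P) + 2 * (1 - m) := by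
        gcongr
        exact (integral_abs_le_sqrt mW).trans
          (Real.sqrt_le_sqrt (h.integral_weightedSum_div_sq_le hμ hp mf hf2 hf0 n))
    _ < ε := by
        have := hN n ((le_max_left N 1).trans hn.le)
        linarith

end IsMemoryProcess

/-! ### Expansions of the exponential. -/

section Exponential

theorem norm_cexp_I_mul_sub_sub_le (x : ℝ) :
    ‖Complex.exp (Complex.I * x) - 1 - Complex.I * x‖ ≤ 2 * x ^ 2 := by
  have hx : ‖Complex.I * (x : ℂ)‖ = |x| := by simp
  rcases le_total |x| 1 with h | h
  · have := Complex.norm_exp_sub_one_sub_id_le (x := Complex.I * x) (by rwa [hx])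
    rw [hx, sq_abs] at this
    nlinarith [sq_nonneg x]
  · have h1 : ‖Complex.exp (Complex.I * x) - 1‖ ≤ ‖x‖ := Real.norm_exp_I_mul_ofReal_sub_one_le
    have h2 := norm_sub_le (Complex.exp (Complex.I * x) - 1) (Complex.I * x)
    rw [hx] at h2
    rw [Real.norm_eq_abs] at h1
    nlinarith [sq_abs x]

/-- The remainder of the second order expansion of `exp (I * x)`. -/
noncomputable def expRem (x : ℝ) : ℂ :=
  Complex.exp (Complex.I * x) - 1 - Complex.I * x + x ^ 2 / 2

/-- Cubic near 0 and quadratic at infinity, so that only second moments are needed. -/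
theorem norm_expRem_le (x : ℝ) : ‖expRem x‖ ≤ 4 * (x ^ 2 * min 1 |x|) := by
  have hx : ‖Complex.I * (x : ℂ)‖ = |x| := by simp
  rcases le_total |x| 1 with h | h
  · rw [min_eq_right h]
    have h1 := Complex.exp_bound (x := Complex.I * x) (by rwa [hx]) (n := 3) (by norm_num)
    have e : ∑ m ∈ Finset.range 3, (Complex.I * (x : ℂ)) ^ m / (m.factorial : ℂ) =
        1 + Complex.I * x - x ^ 2 / 2 := by
      simp [Finset.sum_range_succ, Nat.factorial, mul_pow, Complex.I_sq]
      ring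
    rw [e, hx] at h1
    have e2 : expRem x = Complex.exp (Complex.I * x) - (1 + Complex.I * x - x ^ 2 / 2) := by
      rw [expRem]; ring
    rw [e2]
    refine h1.trans ?_
    norm_num [Nat.factorial]
    have : |x| ^ 3 = x ^ 2 * |x| := by rw [pow_succ, sq_abs]
    rw [this]
    have : 0 ≤ x ^ 2 * |x| := by positivity
    linarith
  · rw [min_eq_left h]
    have h1 := norm_cexp_I_mul_sub_sub_le x
    have h2 := norm_add_le (Complex.exp (Complex.I * x) - 1 - Complex.I * x) ((x : ℂ) ^ 2 / 2)
    have h3 : ‖(x : ℂ) ^ 2 / 2‖ = x ^ 2 / 2 := by simp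
    rw [h3] at h2
    rw [expRem]
    nlinarith [sq_nonneg x]

theorem abs_exp_neg_sub_le {u : ℝ} (hu : 0 ≤ u) : |Real.exp (-u) - 1 + u| ≤ u ^ 2 := by
  rcases le_total u 1 with h | h
  · have := Real.abs_exp_sub_one_sub_id_le (x := -u) (by rwa [abs_neg, abs_of_nonneg hu])
    simpa using this
  · have h1 := Real.exp_pos (-u)
    have h2 : Real.exp (-u) ≤ 1 := Real.exp_le_one_iff.2 (by linarith)
    rw [abs_le]
    constructor <;> nlinarith

/-- To second order the mixture is `1 + iθp y - θ²/2 * (p z + 1 - p)`, with `y` and `z` the weighted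
first and second moments. If `z` is near 1 and `y` is small, this matches a phase times a Gaussian
factor. -/
theorem norm_mixture_sub_le {ι : Type*} (s : Finset ι) (w x : ι → ℝ) (hw : ∀ k ∈ s, 0 ≤ w k)
    (hw1 : ∑ k ∈ s, w k = 1) {p : ℝ} (hp : p ∈ Set.Icc (0 : ℝ) 1) (θ : ℝ) (φ : ℂ) :
    ‖∑ k ∈ s, (w k : ℂ) * (p * Complex.exp (Complex.I * (θ * x k : ℝ)) + (1 - p) * φ) -
      Complex.exp (Complex.I * (θ * p * ∑ k ∈ s, w k * x k : ℝ)) * (Real.exp (-(θ ^ 2 / 2)) : ℝ)‖ ≤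
    ∑ k ∈ s, w k * ‖expRem (θ * x k)‖ + ‖φ - 1 + θ ^ 2 / 2‖ +
      θ ^ 2 / 2 * |∑ k ∈ s, w k * x k ^ 2 - 1| + 5 / 2 * θ ^ 2 * (∑ k ∈ s, w k * x k) ^ 2 + θ ^ 4 := by
  set y : ℝ := ∑ k ∈ s, w k * x k with hy
  set z : ℝ := ∑ k ∈ s, w k * x k ^ 2 with hz
  set E : ℂ := Complex.exp (Complex.I * (θ * p * y : ℝ)) with hE
  set d : ℝ := Real.exp (-(θ ^ 2 / 2)) - 1 + θ ^ 2 / 2 with hd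
  have hw1' : ∑ k ∈ s, (w k : ℂ) = 1 := by exact_mod_cast hw1
  have hG : ∑ k ∈ s, (w k : ℂ) * (p * Complex.exp (Complex.I * (θ * x k : ℝ)) + (1 - p) * φ) =
      p * ∑ k ∈ s, (w k : ℂ) * expRem (θ * x k) +
        (p * (1 + Complex.I * θ * y - θ ^ 2 / 2 * z) + (1 - p) * φ) := by
    have e : ∀ k ∈ s, (w k : ℂ) * (p * Complex.exp (Complex.I * (θ * x k : ℝ)) + (1 - p) * φ) =
        p * ((w k : ℂ) * expRem (θ * x k)) + p * (w k + Complex.I * θ * (w k * x k : ℝ) -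
          θ ^ 2 / 2 * (w k * x k ^ 2 : ℝ)) + w k * ((1 - p) * φ) := by
      intro k _
      rw [expRem]; push_cast; ring
    rw [Finset.sum_congr rfl e, Finset.sum_add_distrib, Finset.sum_add_distrib, ← Finset.mul_sum,
      ← Finset.mul_sum, ← Finset.sum_mul, Finset.sum_sub_distrib, Finset.sum_add_distrib,
      ← Finset.mul_sum, ← Finset.mul_sum, hw1', hy, hz]
    push_cast
    ring
  -- The six pieces: Taylor remainders, the fresh copy, the defect of `z`, the curvature of the
  -- phase, the cross term, and the expansion of the Gaussian factor.
  have hdec : ∑ k ∈ s, (w k : ℂ) * (p * Complex.exp (Complex.I * (θ * x k : ℝ)) + (1 - p) * φ) -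
      E * (Real.exp (-(θ ^ 2 / 2)) : ℝ) =
      p * ∑ k ∈ s, (w k : ℂ) * expRem (θ * x k) + (1 - p) * (φ - 1 + θ ^ 2 / 2) -
        p * (θ ^ 2 / 2) * (z - 1) - (E - 1 - Complex.I * (θ * p * y : ℝ)) +
        θ ^ 2 / 2 * (E - 1) - E * d := by
    rw [hG, hd]; push_cast; ring
  have n1 : ‖(p : ℂ) * ∑ k ∈ s, (w k : ℂ) * expRem (θ * x k)‖ ≤
      ∑ k ∈ s, w k * ‖expRem (θ * x k)‖ := by
    have hb : ‖∑ k ∈ s, (w k : ℂ) * expRem (θ * x k)‖ ≤ ∑ k ∈ s, w k * ‖expRem (θ * x k)‖ := by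
      refine norm_sum_le_of_le _ fun k hk => ?_
      rw [norm_mul, Complex.norm_real, Real.norm_of_nonneg (hw k hk)]
    rw [norm_mul, Complex.norm_real, Real.norm_of_nonneg hp.1]
    exact (mul_le_of_le_one_left (norm_nonneg _) hp.2).trans hb
  have n2 : ‖((1 : ℂ) - p) * (φ - 1 + θ ^ 2 / 2)‖ ≤ ‖φ - 1 + θ ^ 2 / 2‖ := by
    rw [norm_mul]
    refine mul_le_of_le_one_left (norm_nonneg _) ?_
    rw [← Complex.ofReal_one, ← Complex.ofReal_sub, Complex.norm_real, Real.norm_of_nonneg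
      (by linarith [hp.2])]
    linarith [hp.1]
  have n3 : ‖(p : ℂ) * (θ ^ 2 / 2) * (z - 1)‖ ≤ θ ^ 2 / 2 * |z - 1| := by
    have e : (p : ℂ) * (θ ^ 2 / 2) * (z - 1) = ((p * (θ ^ 2 / 2) * (z - 1) : ℝ) : ℂ) := by push_cast; ring
    rw [e, Complex.norm_real, Real.norm_eq_abs, abs_mul, abs_mul, abs_of_nonneg hp.1,
      abs_of_nonneg (by positivity : 0 ≤ θ ^ 2 / 2), mul_assoc]
    exact mul_le_of_le_one_left (by positivity) hp.2
  have hp2 : p ^ 2 ≤ 1 := pow_le_one₀ hp.1 hp.2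
  have hsq : (θ * p * y) ^ 2 ≤ θ ^ 2 * y ^ 2 := by
    have : (θ * p * y) ^ 2 = p ^ 2 * (θ ^ 2 * y ^ 2) := by ring
    rw [this]
    exact mul_le_of_le_one_left (by positivity) hp2
  have n4 : ‖E - 1 - Complex.I * (θ * p * y : ℝ)‖ ≤ 2 * (θ ^ 2 * y ^ 2) :=
    (norm_cexp_I_mul_sub_sub_le _).trans (by linarith)
  have n5 : ‖(θ : ℂ) ^ 2 / 2 * (E - 1)‖ ≤ θ ^ 2 / 2 * (θ ^ 2 + y ^ 2) := by
    have e : (θ : ℂ) ^ 2 / 2 = ((θ ^ 2 / 2 : ℝ) : ℂ) := by push_cast; ring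
    rw [norm_mul, e, Complex.norm_real, Real.norm_of_nonneg (by positivity)]
    have h1 : ‖E - 1‖ ≤ ‖θ * p * y‖ := Real.norm_exp_I_mul_ofReal_sub_one_le
    rw [Real.norm_eq_abs] at h1
    have h2 : |θ * p * y| ≤ θ ^ 2 + y ^ 2 := by
      rw [abs_mul, abs_mul, abs_of_nonneg hp.1]
      have : |θ| * p * |y| ≤ |θ| * |y| :=
        mul_le_mul_of_nonneg_right (mul_le_of_le_one_right (abs_nonneg _) hp.2) (abs_nonneg _)
      nlinarith [sq_abs θ, sq_abs y, sq_nonneg (|θ| - |y|), abs_nonneg θ, abs_nonneg y]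
    exact mul_le_mul_of_nonneg_left (h1.trans h2) (by positivity)
  have n6 : ‖E * (d : ℂ)‖ ≤ θ ^ 4 / 4 := by
    rw [norm_mul, hE, Complex.norm_exp_I_mul_ofReal, one_mul, Complex.norm_real, Real.norm_eq_abs]
    refine (abs_exp_neg_sub_le (by positivity)).trans (le_of_eq ?_)
    ring
  rw [hdec]
  refine (norm_sub_le _ _).trans ?_
  have t1 := norm_add_le ((p : ℂ) * ∑ k ∈ s, (w k : ℂ) * expRem (θ * x k) +
    (1 - p) * (φ - 1 + θ ^ 2 / 2) - p * (θ ^ 2 / 2) * (z - 1) -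
      (E - 1 - Complex.I * (θ * p * y : ℝ))) (θ ^ 2 / 2 * (E - 1))
  have t2 := norm_sub_le ((p : ℂ) * ∑ k ∈ s, (w k : ℂ) * expRem (θ * x k) +
    (1 - p) * (φ - 1 + θ ^ 2 / 2) - p * (θ ^ 2 / 2) * (z - 1))
      (E - 1 - Complex.I * (θ * p * y : ℝ))
  have t3 := norm_sub_le ((p : ℂ) * ∑ k ∈ s, (w k : ℂ) * expRem (θ * x k) +
    (1 - p) * (φ - 1 + θ ^ 2 / 2)) ((p : ℂ) * (θ ^ 2 / 2) * (z - 1))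
  have t4 := norm_add_le ((p : ℂ) * ∑ k ∈ s, (w k : ℂ) * expRem (θ * x k))
    ((1 - p) * (φ - 1 + θ ^ 2 / 2))
  have hθ4 : 0 ≤ θ ^ 4 := by positivity
  have n5' : θ ^ 2 / 2 * (θ ^ 2 + y ^ 2) = θ ^ 4 / 2 + 1 / 2 * θ ^ 2 * y ^ 2 := by ring
  rw [n5'] at n5
  linarith

/-- Multiplication by `exp (-u n) ≤ 1` never enlarges earlier errors, so they only add up. -/
theorem norm_sub_exp_neg_sum_le {φ : ℕ → ℂ} {u η : ℕ → ℝ} (h0 : φ 0 = 1) (hu : ∀ n, 0 ≤ u n)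
    {N : ℕ} (h : ∀ n < N, ‖φ (n + 1) - φ n * (Real.exp (-u n) : ℝ)‖ ≤ η n) :
    ‖φ N - (Real.exp (-∑ n ∈ Finset.range N, u n) : ℝ)‖ ≤ ∑ n ∈ Finset.range N, η n := by
  induction N with
  | zero => simp [h0]
  | succ N ih =>
    have h1 := ih fun n hn => h n (by omega)
    have h2 := h N (by omega)
    rw [Finset.sum_range_succ, Finset.sum_range_succ, neg_add, Real.exp_add]
    have e : φ (N + 1) - ((Real.exp (-∑ n ∈ Finset.range N, u n) * Real.exp (-u N) : ℝ) : ℂ) =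
        (φ N - (Real.exp (-∑ n ∈ Finset.range N, u n) : ℝ)) * (Real.exp (-u N) : ℝ) +
          (φ (N + 1) - φ N * (Real.exp (-u N) : ℝ)) := by push_cast; ring
    rw [e]
    refine (norm_add_le _ _).trans (add_le_add (le_trans ?_ h1) h2)
    rw [norm_mul, Complex.norm_real, Real.norm_of_nonneg (Real.exp_pos _).le]
    exact mul_le_of_le_one_right (norm_nonneg _) (Real.exp_le_one_iff.2 (by linarith [hu N]))

end Exponential

/-- `E [U² min (1, θ |U|)]`. -/
noncomputable def truncMoment [MeasurableSpace Ω] (P : Measure Ω) (U : Ω → ℝ) (θ : ℝ) : ℝ :=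
  ∫ ω, U ω ^ 2 * min 1 (θ * |U ω|) ∂P

/-! ### Truncated second moments and the martingale central limit theorem. -/

section TruncMoment

variable [mΩ : MeasurableSpace Ω] {P : Measure Ω} {U : Ω → ℝ}

theorem integrable_truncMoment (hU : Measurable U) (h2 : Integrable (fun ω => U ω ^ 2) P) {θ : ℝ}
    (hθ : 0 ≤ θ) : Integrable (fun ω => U ω ^ 2 * min 1 (θ * |U ω|)) P := by
  refine h2.mono (by fun_prop) (Eventually.of_forall fun ω => ?_)
  rw [norm_mul, Real.norm_of_nonneg (le_min zero_le_one (by positivity) : 0 ≤ min 1 (θ * |U ω|))]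
  exact mul_le_of_le_one_right (norm_nonneg _) (min_le_left _ _)

theorem truncMoment_mono (hU : Measurable U) (h2 : Integrable (fun ω => U ω ^ 2) P) {θ τ : ℝ}
    (hθ : 0 ≤ θ) (hτ : θ ≤ τ) : truncMoment P U θ ≤ truncMoment P U τ :=
  integral_mono (integrable_truncMoment hU h2 hθ) (integrable_truncMoment hU h2 (hθ.trans hτ))
    fun ω => by dsimp only; gcongr

theorem truncMoment_nonneg {θ : ℝ} (hθ : 0 ≤ θ) : 0 ≤ truncMoment P U θ :=
  integral_nonneg fun ω => mul_nonneg (sq_nonneg _) (le_min zero_le_one (by positivity))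

/-- Dominated convergence with bound `U²`; this plays the role of the Lindeberg condition. -/
theorem tendsto_truncMoment (hU : Measurable U) (h2 : Integrable (fun ω => U ω ^ 2) P)
    {τ : ℕ → ℝ} (hτ0 : ∀ n, 0 ≤ τ n) (hτ : Tendsto τ atTop (𝓝 0)) :
    Tendsto (fun n => truncMoment P U (τ n)) atTop (𝓝 0) := by
  have : Tendsto (fun n => truncMoment P U (τ n)) atTop (𝓝 (∫ _, (0 : ℝ) ∂P)) := by
    refine tendsto_integral_of_dominated_convergence (fun ω => U ω ^ 2)
      (fun n => (integrable_truncMoment hU h2 (hτ0 n)).1) h2 (fun n => ?_) ?_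
    · refine Eventually.of_forall fun ω => ?_
      have := hτ0 n
      rw [norm_mul, Real.norm_of_nonneg (le_min zero_le_one (by positivity) : 0 ≤ min 1 (τ n * |U ω|)),
        Real.norm_of_nonneg (sq_nonneg _)]
      exact mul_le_of_le_one_right (sq_nonneg _) (min_le_left _ _)
    · refine Eventually.of_forall fun ω => ?_
      have h1 : Tendsto (fun n => U ω ^ 2 * min 1 (τ n * |U ω|)) atTop
          (𝓝 (U ω ^ 2 * min 1 (0 * |U ω|))) :=
        ((tendsto_const_nhds.min (hτ.mul_const _))).const_mul _
      simpa using h1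
  simpa using this

theorem norm_expRem_mul_le (θ x : ℝ) :
    ‖expRem (θ * x)‖ ≤ 4 * θ ^ 2 * (x ^ 2 * min 1 (|θ| * |x|)) := by
  refine (norm_expRem_le _).trans (le_of_eq ?_)
  rw [abs_mul]; ring

theorem norm_integral_cexp_sub_le [IsProbabilityMeasure P] (hU : Measurable U)
    (h2 : Integrable (fun ω => U ω ^ 2) P)
    (hU1 : Integrable U P) (hU0 : ∫ ω, U ω ∂P = 0) (hv : ∫ ω, U ω ^ 2 ∂P = 1) (θ : ℝ) :
    ‖∫ ω, Complex.exp (Complex.I * (θ * U ω : ℝ)) ∂P - 1 + θ ^ 2 / 2‖ ≤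
      4 * θ ^ 2 * truncMoment P U |θ| := by
  have i0 : Integrable (fun ω => Complex.exp (Complex.I * (θ * U ω : ℝ))) P :=
    Integrable.of_bound (by fun_prop) 1 (Eventually.of_forall fun ω =>
      (Complex.norm_exp_I_mul_ofReal _).le)
  have i1 : Integrable (fun ω => Complex.I * θ * (U ω : ℂ)) P := hU1.ofReal.const_mul _
  have i2 : Integrable (fun ω => (θ : ℂ) ^ 2 / 2 * ((U ω ^ 2 : ℝ) : ℂ)) P := h2.ofReal.const_mul _
  have i3 : Integrable (fun ω => Complex.exp (Complex.I * (θ * U ω : ℝ)) - 1) P :=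
    i0.sub (integrable_const _)
  have i4 : Integrable (fun ω => Complex.exp (Complex.I * (θ * U ω : ℝ)) - 1 -
    Complex.I * θ * (U ω : ℂ)) P := i3.sub i1
  have e : ∫ ω, Complex.exp (Complex.I * (θ * U ω : ℝ)) ∂P - 1 + θ ^ 2 / 2 =
      ∫ ω, expRem (θ * U ω) ∂P := by
    have e1 : ∀ ω, expRem (θ * U ω) = Complex.exp (Complex.I * (θ * U ω : ℝ)) - 1 -
        Complex.I * θ * (U ω : ℂ) + (θ : ℂ) ^ 2 / 2 * ((U ω ^ 2 : ℝ) : ℂ) := by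
      intro ω; rw [expRem]; push_cast; ring
    simp only [e1]
    rw [integral_add i4 i2, integral_sub i3 i1, integral_sub i0 (integrable_const _),
      integral_const_mul, integral_const_mul, integral_complex_ofReal, integral_complex_ofReal,
      hU0, hv]
    simp
  rw [e, truncMoment, ← integral_const_mul]
  exact norm_integral_le_of_norm_le ((integrable_truncMoment hU h2 (abs_nonneg θ)).const_mul _)
    (Eventually.of_forall fun ω => norm_expRem_mul_le _ _)

end TruncMoment

/-- Summation by parts: `Y (k+1)` is its innovation plus `p * M k / (a k * ν k)`, and `1 / (a k * ν
k)` is the increment of `invSum`. -/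
theorem sum_sub_mul_weightedSum {p : ℝ} {μ : ℕ → ℝ} (hμ : ∀ n, 1 ≤ n → 0 < μ n) (hp : 0 ≤ p) (Y : ℕ → Ω → ℝ) (n : ℕ)
    (ω : Ω) :
    ∑ k ∈ Finset.Icc 1 n, Y k ω - p * invSum p μ n * (a p μ n * weightedSum μ Y id n ω) =
      ∑ j ∈ Finset.Icc 1 n, (1 - p * (a p μ j * μ j * invSum p μ j)) * innov p μ Y id j ω := by
  induction n with
  | zero => simp [weightedSum_zero]
  | succ n ih =>
    rw [Finset.sum_Icc_succ_top (by omega), Finset.sum_Icc_succ_top (by omega), ← ih]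
    rcases Nat.eq_zero_or_pos n with rfl | hn
    · simp [weightedSum_zero, innov_one, invSum]
    · have ha := a_pos hμ hp n
      have ha' := a_pos hμ hp (n + 1)
      have hν := nu_pos hμ hn
      have e1 : a p μ (n + 1) * weightedSum μ Y id (n + 1) ω = a p μ n * weightedSum μ Y id n ω +
          a p μ (n + 1) * μ (n + 1) * innov p μ Y id (n + 1) ω := by
        rw [a_mul_weightedSum hμ hp, a_mul_weightedSum hμ hp, Finset.sum_Icc_succ_top (by omega)]
      have e2 : Y (n + 1) ω = innov p μ Y id (n + 1) ω +
          p * (a p μ n * nu μ n)⁻¹ * (a p μ n * weightedSum μ Y id n ω) := by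
        rw [innov_succ]
        simp only [id]
        field_simp
        ring
      rw [e1, e2, invSum_succ p μ hn]
      ring

namespace IsMemoryProcess

variable [mΩ : MeasurableSpace Ω] {P : Measure Ω} [IsProbabilityMeasure P] {p : ℝ} {μ : ℕ → ℝ}
  {Y : ℕ → Ω → ℝ} {ℱ : ℕ → MeasurableSpace Ω}

theorem integrable_cexp {U : Ω → ℝ} (hU : Measurable U) :
    Integrable (fun ω => Complex.exp (Complex.I * (U ω : ℝ))) P :=
  Integrable.of_bound (by fun_prop) 1 (Eventually.of_forall fun ω =>
    (Complex.norm_exp_I_mul_ofReal _).le)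

/-- One step of the comparison of the characteristic function of `a n * ∑ μ k * Y k` with that of
a Gaussian variable. -/
theorem norm_integral_cexp_step_le (h : IsMemoryProcess P p μ Y ℱ) (hμ : ∀ n, 1 ≤ n → 0 < μ n)
    (hp : p ∈ Set.Icc (0 : ℝ) 1) (h2 : Integrable (fun ω => Y 1 ω ^ 2) P)
    (h0 : ∫ ω, Y 1 ω ∂P = 0) (h1 : ∫ ω, Y 1 ω ^ 2 ∂P = 1) (s : ℝ) (n : ℕ) {θ : ℝ}
    (hθ : θ = s * (a p μ (n + 1) * μ (n + 1))) :
    ‖∫ ω, Complex.exp (Complex.I * (s * (a p μ (n + 1) * weightedSum μ Y id (n + 1) ω) : ℝ)) ∂P -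
      (∫ ω, Complex.exp (Complex.I * (s * (a p μ n * weightedSum μ Y id n ω) : ℝ)) ∂P) *
        (Real.exp (-(θ ^ 2 / 2)) : ℝ)‖ ≤
    θ ^ 2 * (8 * truncMoment P (Y 1) |θ| +
      ∫ ω, |weightedSum μ Y (fun x => x ^ 2) n ω / nu μ n - 1| ∂P +
      5 / 2 * ∫ ω, (weightedSum μ Y id n ω / nu μ n) ^ 2 ∂P + θ ^ 2) := by
  have m1 := h.measurable 1
  have iY : Integrable (Y 1) P :=
    ((memLp_two_iff_integrable_sq m1.aestronglyMeasurable).2 h2).integrable one_le_two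
  have hφ := norm_integral_cexp_sub_le m1 h2 iY h0 h1 θ
  set φ : ℂ := ∫ ω, Complex.exp (Complex.I * (θ * Y 1 ω : ℝ)) ∂P with hφdef
  have hω : 0 ≤ truncMoment P (Y 1) |θ| := truncMoment_nonneg (abs_nonneg θ)
  have hε : 0 ≤ ∫ ω, |weightedSum μ Y (fun x => x ^ 2) n ω / nu μ n - 1| ∂P :=
    integral_nonneg fun ω => abs_nonneg _
  have hκ : 0 ≤ ∫ ω, (weightedSum μ Y id n ω / nu μ n) ^ 2 ∂P :=
    integral_nonneg fun ω => sq_nonneg _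
  have hθ2 : 0 ≤ θ ^ 2 := sq_nonneg θ
  -- At `n = 0` there is no past: the weighted sum is 0, `a 1 = 1`, and the step compares `φ` with
  -- the Gaussian factor directly.
  rcases Nat.eq_zero_or_pos n with rfl | hn
  · have e1 : ∀ ω, s * (a p μ (0 + 1) * weightedSum μ Y id (0 + 1) ω) = θ * Y 1 ω := by
      intro ω
      rw [weightedSum_succ, weightedSum_zero, hθ]
      simp; ring
    have e0 : ∀ ω, s * (a p μ 0 * weightedSum μ Y id 0 ω) = 0 := by
      intro ω; rw [weightedSum_zero]; ring
    simp only [e1, e0]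
    rw [← hφdef]
    have hd := abs_exp_neg_sub_le (u := θ ^ 2 / 2) (by positivity)
    have e3 : φ - (∫ ω, Complex.exp (Complex.I * ((0 : ℝ) : ℂ)) ∂P) * (Real.exp (-(θ ^ 2 / 2)) : ℝ) =
        (φ - 1 + θ ^ 2 / 2) - ((Real.exp (-(θ ^ 2 / 2)) - 1 + θ ^ 2 / 2 : ℝ) : ℂ) := by
      simp
    rw [e3]
    refine (norm_sub_le _ _).trans ?_
    rw [Complex.norm_real, Real.norm_eq_abs]
    nlinarith [mul_nonneg hθ2 hω, mul_nonneg hθ2 hε, mul_nonneg hθ2 hκ, mul_nonneg hθ2 hθ2]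
  have hν := nu_pos hμ hn
  set W : Ω → ℝ := weightedSum μ Y id n with hW
  have mW : Measurable[ℱ n] W := h.measurable_weightedSum measurable_id n
  have mW' : Measurable W := mW.mono (h.le n) le_rfl
  set H : Ω → ℂ := fun ω => Complex.exp (Complex.I * (s * a p μ (n + 1) * W ω : ℝ)) with hH
  have mH : Measurable[ℱ n] H := by
    have : Measurable fun x : ℝ => Complex.exp (Complex.I * (s * a p μ (n + 1) * x : ℝ)) := by fun_prop
    exact this.comp mW
  have nH : ∀ ω, ‖H ω‖ = 1 := fun ω => Complex.norm_exp_I_mul_ofReal _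
  have iH : Integrable H P := integrable_cexp (by fun_prop)
  set g : ℝ → ℂ := fun x => Complex.exp (Complex.I * (θ * x : ℝ)) with hg
  have mg : Measurable g := by fun_prop
  have ig : ∀ k, Integrable (fun ω => g (Y k ω)) P := fun k => by
    have := h.measurable k
    exact integrable_cexp (by fun_prop)
  have iHg : ∀ k, Integrable (fun ω => H ω * g (Y k ω)) P := fun k =>
    (ig k).bdd_mul (c := 1) iH.1 (Eventually.of_forall fun ω => (nH ω).le)
  obtain ⟨-, hstep⟩ := h.integral_step n hn H mH iH g mg (ig 1) fun k _ => iHg k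
  set w : ℕ → ℝ := fun k => μ k / nu μ n with hw
  have hw0 : ∀ k ∈ Finset.Icc 1 n, 0 ≤ w k := fun k hk =>
    (div_pos (hμ k (Finset.mem_Icc.1 hk).1) hν).le
  have hw1 : ∑ k ∈ Finset.Icc 1 n, w k = 1 := sum_div_nu hμ hn
  set G : Ω → ℂ := fun ω => ∑ k ∈ Finset.Icc 1 n,
    (w k : ℂ) * (p * Complex.exp (Complex.I * (θ * Y k ω : ℝ)) + (1 - p) * φ) with hG
  set E : Ω → ℂ := fun ω => Complex.exp (Complex.I * (θ * p * ∑ k ∈ Finset.Icc 1 n, w k * Y k ω : ℝ))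
    with hE
  have hy : ∀ ω, ∑ k ∈ Finset.Icc 1 n, w k * Y k ω = W ω / nu μ n := by
    intro ω
    rw [hW, weightedSum, Finset.sum_div]
    refine Finset.sum_congr rfl fun k _ => ?_
    simp only [hw, id]; ring
  have hz : ∀ ω, ∑ k ∈ Finset.Icc 1 n, w k * Y k ω ^ 2 =
      weightedSum μ Y (fun x => x ^ 2) n ω / nu μ n := by
    intro ω
    rw [weightedSum, Finset.sum_div]
    refine Finset.sum_congr rfl fun k _ => ?_
    simp only [hw]; ring
  have f1 : ∫ ω, Complex.exp (Complex.I *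
      (s * (a p μ (n + 1) * weightedSum μ Y id (n + 1) ω) : ℝ)) ∂P = ∫ ω, H ω * G ω ∂P := by
    have e : ∀ ω, Complex.exp (Complex.I *
        (s * (a p μ (n + 1) * weightedSum μ Y id (n + 1) ω) : ℝ)) = H ω * g (Y (n + 1) ω) := by
      intro ω
      simp only [hH, hg]
      rw [← Complex.exp_add, weightedSum_succ, hθ]
      congr 1
      simp only [id, ← hW]
      push_cast; ring
    simp only [e]
    rw [hstep]
    have e2 : ∀ ω, H ω * G ω = ∑ k ∈ Finset.Icc 1 n,
        ((w k : ℂ) * (p * (H ω * g (Y k ω))) + (w k : ℂ) * ((1 - p) * φ) * H ω) := by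
      intro ω
      simp only [hG, hg]
      rw [Finset.mul_sum]
      refine Finset.sum_congr rfl fun k _ => ?_
      ring
    have i1 : ∀ k, Integrable (fun ω => (w k : ℂ) * (p * (H ω * g (Y k ω)))) P := fun k =>
      ((iHg k).const_mul _).const_mul _
    have i2 : ∀ k, Integrable (fun ω => (w k : ℂ) * ((1 - p) * φ) * H ω) P := fun k =>
      iH.const_mul _
    simp only [e2]
    have i12 : ∀ k, Integrable (fun ω => (w k : ℂ) * (p * (H ω * g (Y k ω))) +
        (w k : ℂ) * ((1 - p) * φ) * H ω) P := fun k => (i1 k).add (i2 k)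
    rw [integral_finsetSum _ fun k _ => i12 k]
    refine Finset.sum_congr rfl fun k _ => ?_
    rw [integral_add (i1 k) (i2 k), integral_const_mul, integral_const_mul, integral_const_mul]
    simp only [hw, hφdef, hg]
    ring
  -- The phase `E` carries the conditional drift and replaces `a (n+1)` by `a n`.
  have f2 : (∫ ω, Complex.exp (Complex.I * (s * (a p μ n * W ω) : ℝ)) ∂P) =
      ∫ ω, H ω * E ω ∂P := by
    refine integral_congr_ae (Eventually.of_forall fun ω => ?_)
    simp only [hH, hE]
    rw [← Complex.exp_add, hy, hθ, a_eq_mul_succ hμ hp.1 hn]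
    congr 1
    push_cast; ring
  have mE : Measurable E := by
    simp only [hE, hy]
    fun_prop
  have iE : Integrable (fun ω => H ω * E ω) P :=
    iH.mul_bdd (c := 1) mE.aestronglyMeasurable
      (Eventually.of_forall fun ω => (Complex.norm_exp_I_mul_ofReal _).le)
  have iG : Integrable (fun ω => H ω * G ω) P := by
    refine Integrable.bdd_mul (c := 1) ?_ iH.1 (Eventually.of_forall fun ω => (nH ω).le)
    exact integrable_finsetSum _ fun k _ =>
      (((ig k).const_mul _).add (integrable_const _)).const_mul _
  rw [f1, f2, ← integral_mul_const, ← integral_sub iG (iE.mul_const _)]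
  have iR : ∀ k, 1 ≤ k → Integrable (fun ω => Y k ω ^ 2 * min 1 (|θ| * |Y k ω|)) P ∧
      ∫ ω, Y k ω ^ 2 * min 1 (|θ| * |Y k ω|) ∂P = truncMoment P (Y 1) |θ| := fun k hk =>
    h.integral_comp hμ (g := fun x => x ^ 2 * min 1 (|θ| * |x|)) (by fun_prop)
      (integrable_truncMoment m1 h2 (abs_nonneg θ)) hk
  have b0 : Integrable (fun ω => ∑ k ∈ Finset.Icc 1 n,
      w k * (4 * θ ^ 2 * (Y k ω ^ 2 * min 1 (|θ| * |Y k ω|)))) P :=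
    integrable_finsetSum _ fun k hk => ((iR k (Finset.mem_Icc.1 hk).1).1.const_mul _).const_mul _
  have b0v : ∫ ω, ∑ k ∈ Finset.Icc 1 n,
      w k * (4 * θ ^ 2 * (Y k ω ^ 2 * min 1 (|θ| * |Y k ω|))) ∂P =
      4 * θ ^ 2 * truncMoment P (Y 1) |θ| := by
    rw [integral_finsetSum _ fun k hk =>
      ((iR k (Finset.mem_Icc.1 hk).1).1.const_mul _).const_mul _]
    have : ∀ k ∈ Finset.Icc 1 n, ∫ ω, w k * (4 * θ ^ 2 * (Y k ω ^ 2 * min 1 (|θ| * |Y k ω|))) ∂P =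
        w k * (4 * θ ^ 2 * truncMoment P (Y 1) |θ|) := fun k hk => by
      rw [integral_const_mul, integral_const_mul, (iR k (Finset.mem_Icc.1 hk).1).2]
    rw [Finset.sum_congr rfl this, ← Finset.sum_mul, hw1, one_mul]
  have b1 : Integrable (fun ω => |weightedSum μ Y (fun x => x ^ 2) n ω / nu μ n - 1|) P := by
    refine Integrable.abs (Integrable.sub ?_ (integrable_const _))
    refine Integrable.div_const ?_ _
    exact integrable_finsetSum _ fun k hk => (h.integral_comp hμ (g := fun x => x ^ 2)
      (by fun_prop) h2 (Finset.mem_Icc.1 hk).1).1.const_mul _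
  have b2 : Integrable (fun ω => (W ω / nu μ n) ^ 2) P := by
    have : MemLp (fun ω => W ω / nu μ n) 2 P := by
      simp only [div_eq_mul_inv]
      exact (h.memLp_weightedSum hμ measurable_id h2 n).mul_const _
    exact this.integrable_sq
  have b01 : Integrable (fun ω => ∑ k ∈ Finset.Icc 1 n,
      w k * (4 * θ ^ 2 * (Y k ω ^ 2 * min 1 (|θ| * |Y k ω|))) + 4 * θ ^ 2 * truncMoment P (Y 1) |θ|) P :=
    b0.add (integrable_const _)
  have b02 : Integrable (fun ω => ∑ k ∈ Finset.Icc 1 n,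
      w k * (4 * θ ^ 2 * (Y k ω ^ 2 * min 1 (|θ| * |Y k ω|))) + 4 * θ ^ 2 * truncMoment P (Y 1) |θ| +
      θ ^ 2 / 2 * |weightedSum μ Y (fun x => x ^ 2) n ω / nu μ n - 1|) P := b01.add (b1.const_mul _)
  have b03 : Integrable (fun ω => ∑ k ∈ Finset.Icc 1 n,
      w k * (4 * θ ^ 2 * (Y k ω ^ 2 * min 1 (|θ| * |Y k ω|))) + 4 * θ ^ 2 * truncMoment P (Y 1) |θ| +
      θ ^ 2 / 2 * |weightedSum μ Y (fun x => x ^ 2) n ω / nu μ n - 1| +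
      5 / 2 * θ ^ 2 * (W ω / nu μ n) ^ 2) P := b02.add (b2.const_mul _)
  have b04 := b03.add (integrable_const (θ ^ 4))
  refine (norm_integral_le_of_norm_le b04 (Eventually.of_forall fun ω => ?_)).trans ?_
  · have e : H ω * G ω - H ω * E ω * (Real.exp (-(θ ^ 2 / 2)) : ℝ) =
        H ω * (G ω - E ω * (Real.exp (-(θ ^ 2 / 2)) : ℝ)) := by ring
    rw [e, norm_mul, nH, one_mul]
    have hmix := norm_mixture_sub_le (Finset.Icc 1 n) w (fun k => Y k ω) hw0 hw1 hp θ φ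
    rw [hz] at hmix
    refine le_trans hmix ?_
    rw [hy]
    simp only [Pi.add_apply]
    have hs : ∑ k ∈ Finset.Icc 1 n, w k * ‖expRem (θ * Y k ω)‖ ≤ ∑ k ∈ Finset.Icc 1 n,
        w k * (4 * θ ^ 2 * (Y k ω ^ 2 * min 1 (|θ| * |Y k ω|))) :=
      Finset.sum_le_sum fun k hk =>
        mul_le_mul_of_nonneg_left (norm_expRem_mul_le θ (Y k ω)) (hw0 k hk)
    gcongr
  · simp only [Pi.add_apply]
    rw [integral_add b03 (integrable_const _), integral_add b02 (b2.const_mul _),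
      integral_add b01 (b1.const_mul _), integral_add b0 (integrable_const _), b0v]
    simp only [integral_const_mul, integral_const, probReal_univ, smul_eq_mul, one_mul]
    nlinarith [mul_nonneg hθ2 hε, mul_nonneg hθ2 hκ]

/-- Central limit theorem for the martingale `a n * ∑ μ k * Y k`, normalized by `v n`. -/
theorem tendsto_integral_cexp (h : IsMemoryProcess P p μ Y ℱ) (hμ : ∀ n, 1 ≤ n → 0 < μ n)
    (hp : p ∈ Set.Icc (0 : ℝ) 1) (h2 : Integrable (fun ω => Y 1 ω ^ 2) P)
    (h0 : ∫ ω, Y 1 ω ∂P = 0) (h1 : ∫ ω, Y 1 ω ^ 2 ∂P = 1)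
    (hκ : Tendsto (fun n => v p μ n ^ 2 / (a p μ n * nu μ n) ^ 2) atTop (𝓝 0))
    (hc : Tendsto (fun n => a p μ n * μ n / v p μ n) atTop (𝓝 0))
    (hv : Tendsto (v p μ) atTop atTop) (t : ℝ) :
    Tendsto (fun n => ∫ ω, Complex.exp (Complex.I *
      (t * (a p μ n * weightedSum μ Y id n ω / v p μ n) : ℝ)) ∂P) atTop
      (𝓝 (Real.exp (-(t ^ 2 / 2)) : ℝ)) := by
  set c : ℕ → ℝ := fun n => (a p μ (n + 1) * μ (n + 1)) ^ 2 with hcdef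
  have hapos : ∀ n, 0 < a p μ (n + 1) * μ (n + 1) := fun n =>
    mul_pos (a_pos hμ hp.1 _) (hμ _ (by omega))
  have hc0 : ∀ n, 0 < c n := fun n => pow_pos (hapos n) 2
  have hV : Tendsto (fun n => ∑ i ∈ Finset.range n, c i) atTop atTop := by
    have : Tendsto (fun n => v p μ n ^ 2) atTop atTop := (tendsto_pow_atTop two_ne_zero).comp hv
    simpa only [v_sq] using this
  -- Normalizing by `v (n+1)` instead of `v N` gives a bound on `|θ|` valid for every `N > n`, so
  -- the error `δ n` does not depend on `N`.
  set τ : ℕ → ℝ := fun n => |t| * (a p μ (n + 1) * μ (n + 1) / v p μ (n + 1)) with hτdef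
  have hτ0 : ∀ n, 0 ≤ τ n := fun n =>
    mul_nonneg (abs_nonneg _) (div_nonneg (hapos n).le (v_nonneg _ _ _))
  have hτ : Tendsto τ atTop (𝓝 0) := by
    simpa using ((tendsto_add_atTop_iff_nat 1).2 hc).const_mul |t|
  set δ : ℕ → ℝ := fun n => 8 * truncMoment P (Y 1) (τ n) +
      ∫ ω, |weightedSum μ Y (fun x => x ^ 2) n ω / nu μ n - 1| ∂P +
      5 / 2 * ∫ ω, (weightedSum μ Y id n ω / nu μ n) ^ 2 ∂P + τ n ^ 2 with hδdef
  have hκ' : Tendsto (fun n => ∫ ω, (weightedSum μ Y id n ω / nu μ n) ^ 2 ∂P) atTop (𝓝 0) := by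
    refine squeeze_zero (fun n => integral_nonneg fun ω => sq_nonneg _) (fun n => ?_) hκ
    have := h.integral_weightedSum_div_sq_le hμ hp.1 measurable_id h2 h0 n
    simpa only [id, h1, mul_one] using this
  have hδ : Tendsto δ atTop (𝓝 0) := by
    have := ((((tendsto_truncMoment (h.measurable 1) h2 hτ0 hτ).const_mul 8).add
      (h.tendsto_integral_abs_weightedSum_sq hμ hp.1 h2 h1 hκ)).add (hκ'.const_mul (5 / 2))).add
      (hτ.pow 2)
    simpa using this
  -- Averages of `δ` with weights `c` tend to 0 because the total weight `v²` diverges.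
  have hS := (tendsto_div_sum_range_of_tendsto_sub_div
    (F := fun n => ∑ i ∈ Finset.range n, c i * δ i) (l := 0) hc0 hV (by
      refine hδ.congr fun k => ?_
      rw [Finset.sum_range_succ, add_sub_cancel_left, mul_div_cancel_left₀ _ (hc0 k).ne'])).const_mul
      (t ^ 2)
  rw [mul_zero] at hS
  rw [tendsto_iff_norm_sub_tendsto_zero]
  refine squeeze_zero' (Eventually.of_forall fun n => norm_nonneg _) ?_ hS
  filter_upwards [eventually_ge_atTop 1] with N hN
  have hvN := v_pos hμ hp.1 hN
  have hvsq := v_sq p μ N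
  change v p μ N ^ 2 = ∑ k ∈ Finset.range N, c k at hvsq
  set φ : ℕ → ℂ := fun n => ∫ ω, Complex.exp (Complex.I *
    ((t / v p μ N) * (a p μ n * weightedSum μ Y id n ω) : ℝ)) ∂P with hφ
  have hφ0 : φ 0 = 1 := by
    simp only [hφ, weightedSum_zero]
    simp
  have hsum : ∑ n ∈ Finset.range N, (t / v p μ N * (a p μ (n + 1) * μ (n + 1))) ^ 2 / 2 = t ^ 2 / 2 := by
    have e : ∀ n ∈ Finset.range N, (t / v p μ N * (a p μ (n + 1) * μ (n + 1))) ^ 2 / 2 =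
        (t / v p μ N) ^ 2 / 2 * c n := fun n _ => by simp only [hcdef]; ring
    rw [Finset.sum_congr rfl e, ← Finset.mul_sum, ← hvsq]
    field_simp
  have hmain := norm_sub_exp_neg_sum_le (φ := φ) (N := N)
    (u := fun n => (t / v p μ N * (a p μ (n + 1) * μ (n + 1))) ^ 2 / 2)
    (η := fun n => t ^ 2 / v p μ N ^ 2 * (c n * δ n)) hφ0 (fun n => by positivity) (by
      intro n hn
      have hst := h.norm_integral_cexp_step_le hμ hp h2 h0 h1 (t / v p μ N) n rfl
      refine hst.trans ?_
      have hvn : v p μ (n + 1) ≤ v p μ N := v_mono p μ (by omega)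
      have hvn0 := v_pos hμ hp.1 (show 1 ≤ n + 1 by omega)
      have hθτ : |t / v p μ N * (a p μ (n + 1) * μ (n + 1))| ≤ τ n := by
        rw [abs_mul, abs_div, abs_of_pos hvN, abs_of_pos (hapos n)]
        simp only [hτdef]
        rw [div_mul_eq_mul_div, ← mul_div_assoc]
        have := (hapos n).le
        gcongr
      have hθ2 : (t / v p μ N * (a p μ (n + 1) * μ (n + 1))) ^ 2 = t ^ 2 / v p μ N ^ 2 * c n := by
        simp only [hcdef]; ring
      have hb : 8 * truncMoment P (Y 1) |t / v p μ N * (a p μ (n + 1) * μ (n + 1))| +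
          ∫ ω, |weightedSum μ Y (fun x => x ^ 2) n ω / nu μ n - 1| ∂P +
          5 / 2 * ∫ ω, (weightedSum μ Y id n ω / nu μ n) ^ 2 ∂P +
          (t / v p μ N * (a p μ (n + 1) * μ (n + 1))) ^ 2 ≤ δ n := by
        have u1 := truncMoment_mono (h.measurable 1) h2 (abs_nonneg _) hθτ
        have u2 : (t / v p μ N * (a p μ (n + 1) * μ (n + 1))) ^ 2 ≤ τ n ^ 2 :=
          sq_le_sq.2 (by rwa [abs_of_nonneg (hτ0 n)])
        simp only [hδdef]
        linarith
      calc _ ≤ (t / v p μ N * (a p μ (n + 1) * μ (n + 1))) ^ 2 * δ n :=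
            mul_le_mul_of_nonneg_left hb (sq_nonneg _)
        _ = _ := by rw [hθ2]; ring)
  rw [hsum, ← Finset.mul_sum] at hmain
  have e1 : ∀ ω, t * (a p μ N * weightedSum μ Y id N ω / v p μ N) =
      t / v p μ N * (a p μ N * weightedSum μ Y id N ω) := fun ω => by ring
  simp only [e1]
  refine hmain.trans (le_of_eq ?_)
  rw [hvsq]
  ring

end IsMemoryProcess

/-! ### Comparison of the walk with the martingale, and conclusion. -/

theorem norm_integral_cexp_sub_integral_cexp_le [MeasurableSpace Ω] {P : Measure Ω}
    [IsProbabilityMeasure P] {U V D : Ω → ℝ} (hU : Measurable U) (hV : Measurable V)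
    (hD : Integrable D P) (h : ∀ ω, |U ω - V ω| ≤ D ω) (t : ℝ) :
    ‖∫ ω, Complex.exp (Complex.I * (t * U ω : ℝ)) ∂P -
      ∫ ω, Complex.exp (Complex.I * (t * V ω : ℝ)) ∂P‖ ≤ |t| * ∫ ω, D ω ∂P := by
  rw [← integral_sub (IsMemoryProcess.integrable_cexp (by fun_prop))
    (IsMemoryProcess.integrable_cexp (by fun_prop)), ← integral_const_mul]
  refine norm_integral_le_of_norm_le (hD.const_mul _) (Eventually.of_forall fun ω => ?_)
  have e : Complex.exp (Complex.I * (t * U ω : ℝ)) - Complex.exp (Complex.I * (t * V ω : ℝ)) =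
      Complex.exp (Complex.I * (t * V ω : ℝ)) *
        (Complex.exp (Complex.I * (t * (U ω - V ω) : ℝ)) - 1) := by
    rw [mul_sub, mul_one, ← Complex.exp_add]
    congr 2
    push_cast; ring
  rw [e, norm_mul, Complex.norm_exp_I_mul_ofReal, one_mul]
  refine (Real.norm_exp_I_mul_ofReal_sub_one_le).trans ?_
  rw [Real.norm_eq_abs, abs_mul]
  exact mul_le_mul_of_nonneg_left (h ω) (abs_nonneg t)

/-- After normalization, the partial sums are close in mean to a multiple of the martingale
`a n * ∑ μ k * Y k`. -/
theorem IsMemoryProcess.exists_tendsto_integral_abs [MeasurableSpace Ω] {P : Measure Ω}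
    [IsProbabilityMeasure P] {p γ : ℝ} {μ : ℕ → ℝ} {Y : ℕ → Ω → ℝ} {ℱ : ℕ → MeasurableSpace Ω}
    (h : IsMemoryProcess P p μ Y ℱ) (hμ : RegularlyVarying μ γ) (hγ : -1 < γ) (hp : 0 ≤ p)
    (hcrit : p = pc γ) (hv : ¬ BddAbove (Set.range (v p μ)))
    (h2 : Integrable (fun ω => Y 1 ω ^ 2) P)
    (h0 : ∫ ω, Y 1 ω ∂P = 0) (h1 : ∫ ω, Y 1 ω ^ 2 ∂P = 1) :
    ∃ D : ℕ → Ω → ℝ, (∀ n, Integrable (D n) P) ∧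
      (∀ n, 1 ≤ n → ∀ ω, |(∑ k ∈ Finset.Icc 1 n, Y k ω) / sigma p μ n -
        (2 * γ + 1) * (a p μ n * weightedSum μ Y id n ω / v p μ n)| ≤ D n ω) ∧
      Tendsto (fun n => ∫ ω, D n ω ∂P) atTop (𝓝 0) := by
  set T : ℕ → Ω → ℝ := fun n ω =>
    ∑ j ∈ Finset.Icc 1 n, (1 - p * (a p μ j * μ j * invSum p μ j)) * innov p μ Y id j ω with hT
  set M : ℕ → Ω → ℝ := fun n ω => a p μ n * weightedSum μ Y id n ω with hM
  set d : ℕ → ℝ := fun n => p * (a p μ n * μ n * invSum p μ n) - (2 * γ + 1) with hd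
  have hA := (hμ.tendsto_mul_invSum hγ hp hcrit).const_mul p
  have hd0 : Tendsto d atTop (𝓝 0) := by
    have hq : p * (2 * (γ + 1)) = 2 * γ + 1 := by
      have : γ + 1 ≠ 0 := by linarith
      rw [hcrit, pc]; field_simp
    rw [hq] at hA
    simpa using hA.sub_const (2 * γ + 1)
  -- The coefficients in the summation by parts converge, hence are bounded, which gives the `√n`
  -- estimate for `T`.
  obtain ⟨B, hB⟩ := (hA.const_sub 1).abs.bddAbove_range
  have hBw : ∀ j, (1 - p * (a p μ j * μ j * invSum p μ j)) ^ 2 ≤ B ^ 2 := fun j => by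
    rw [← sq_abs]
    exact pow_le_pow_left₀ (abs_nonneg _) (hB ⟨j, rfl⟩) 2
  have hid : Integrable (fun ω => id (Y 1 ω) ^ 2) P := h2
  have mT : ∀ n, MemLp (T n) 2 P := fun n => h.memLp_sum_innov hμ.1 measurable_id hid _ n
  have mM : ∀ n, MemLp (M n) 2 P := fun n =>
    (h.memLp_weightedSum hμ.1 measurable_id hid n).const_mul _
  have bT : ∀ n : ℕ, ∫ ω, |T n ω| ∂P ≤ Real.sqrt (B ^ 2 * n) := fun n => by
    refine (integral_abs_le_sqrt (mT n)).trans (Real.sqrt_le_sqrt ?_)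
    refine (h.integral_sum_innov_sq_le hμ.1 measurable_id hid h0 _ n).trans ?_
    simp only [id, h1, mul_one]
    refine (Finset.sum_le_sum fun j _ => hBw j).trans (le_of_eq ?_)
    simp; ring
  have bM : ∀ n, ∫ ω, |M n ω| ∂P ≤ v p μ n := fun n => by
    refine (integral_abs_le_sqrt (mM n)).trans ?_
    refine Real.sqrt_le_iff.2 ⟨v_nonneg _ _ _, ?_⟩
    have := h.integral_a_mul_weightedSum_sq_le hμ.1 hp measurable_id hid h0 n
    simpa only [id, h1, mul_one] using this
  have iT : ∀ n, Integrable (fun ω => |T n ω|) P := fun n => ((mT n).integrable one_le_two).abs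
  have iM : ∀ n, Integrable (fun ω => |M n ω|) P := fun n => ((mM n).integrable one_le_two).abs
  have hr0 : ∀ n, 1 ≤ n → 0 ≤ a p μ n * μ n / v p μ n := fun n hn =>
    div_nonneg (mul_pos (a_pos hμ.1 hp n) (hμ.1 n hn)).le (v_nonneg _ _ _)
  -- The first term is `|T n| / σ n`, small since `n / σ n² → 0`; the second is small since `d n →
  -- 0` and `M n / v n` is bounded in mean.
  refine ⟨fun n ω => a p μ n * μ n / v p μ n * |T n ω| + |d n| / v p μ n * |M n ω|,
    fun n => ((iT n).const_mul _).add ((iM n).const_mul _), fun n hn ω => ?_, ?_⟩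
  · have ha := a_pos hμ.1 hp n
    have hm := hμ.1 n hn
    have hvn := v_pos hμ.1 hp hn
    have hS : ∑ k ∈ Finset.Icc 1 n, Y k ω = T n ω + p * invSum p μ n * M n ω := by
      have := sum_sub_mul_weightedSum hμ.1 hp Y n ω
      simp only [hT, hM]
      linarith
    have e : (∑ k ∈ Finset.Icc 1 n, Y k ω) / sigma p μ n - (2 * γ + 1) * (M n ω / v p μ n) =
        a p μ n * μ n / v p μ n * T n ω + d n / v p μ n * M n ω := by
      rw [hS, sigma_eq hμ.1 hp hn]
      simp only [hd]
      field_simp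
      ring
    change |_ - (2 * γ + 1) * (M n ω / v p μ n)| ≤ _
    rw [e]
    refine (abs_add_le _ _).trans (le_of_eq ?_)
    rw [abs_mul, abs_mul, abs_of_nonneg (hr0 n hn), abs_div, abs_of_pos hvn]
  · have hs : Tendsto (fun n : ℕ => |B| * Real.sqrt (n * (a p μ n * μ n) ^ 2 / v p μ n ^ 2) + |d n|)
        atTop (𝓝 0) := by
      have := ((hμ.tendsto_mul_sq_div_v_sq hγ hp hcrit hv).sqrt.const_mul |B|).add hd0.abs
      simpa using this
    refine squeeze_zero' ?_ ?_ hs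
    · filter_upwards [eventually_ge_atTop 1] with n hn
      have := hr0 n hn
      have := v_nonneg p μ n
      exact integral_nonneg fun ω => by positivity
    · filter_upwards [eventually_ge_atTop 1] with n hn
      have hvn := v_pos hμ.1 hp hn
      have hr := hr0 n hn
      rw [integral_add ((iT n).const_mul _) ((iM n).const_mul _), integral_const_mul,
        integral_const_mul]
      refine add_le_add ?_ ?_
      · refine (mul_le_mul_of_nonneg_left (bT n) hr).trans (le_of_eq ?_)
        have e : (n : ℝ) * (a p μ n * μ n) ^ 2 / v p μ n ^ 2 = n * (a p μ n * μ n / v p μ n) ^ 2 := by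
          ring
        rw [e, Real.sqrt_mul (sq_nonneg B), Real.sqrt_sq_eq_abs,
          Real.sqrt_mul (Nat.cast_nonneg n), Real.sqrt_sq hr]
        ring
      · refine (mul_le_mul_of_nonneg_left (bM n) (by positivity)).trans (le_of_eq ?_)
        field_simp

end RVSRRW

theorem mainTheorem9 {Ω : Type*} [MeasurableSpace Ω] (P : Measure Ω) [IsProbabilityMeasure P]
    (γ : ℝ) (hγ : -1 < γ) (μ : ℕ → ℝ) (hμ : RVSRRW.RegularlyVarying μ γ)
    (p : ℝ) (hp : p ∈ Set.Icc (0 : ℝ) 1)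
    (ξ α : ℕ → Ω → ℝ) (β : ℕ → Ω → ℕ) (hwalk : RVSRRW.IsDriving P p μ ξ α β)
    (hvar : ∫ ω, ξ 1 ω ^ 2 ∂P = 1)
    (hcrit : p = RVSRRW.pc γ)
    (hv : ¬ BddAbove (Set.range (RVSRRW.v p μ))) :
    TendstoInDistribution
      (fun (n : ℕ) (ω : Ω) => RVSRRW.S ξ α β n ω / RVSRRW.sigma p μ n) atTop
      (id : ℝ → ℝ) (fun _ => P)
      (gaussianReal 0 (Real.toNNReal ((2 * γ + 1) ^ 2))) := by
  have h := hwalk.isMemoryProcess hμ.1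
  set Y := RVSRRW.X ξ α β with hY
  have hX1 : Y 1 = ξ 1 := by ext ω; simp [hY, RVSRRW.X, RVSRRW.increment]
  have h1 : ∫ ω, Y 1 ω ^ 2 ∂P = 1 := by rw [hX1]; exact hvar
  have h0 : ∫ ω, Y 1 ω ∂P = 0 := by rw [hX1]; exact hwalk.mean_innovation
  -- A non-integrable function would have integral 0, not 1.
  have h2 : Integrable (fun ω => Y 1 ω ^ 2) P := Integrable.of_integral_ne_zero (by
    rw [h1]; exact one_ne_zero)
  obtain ⟨D, hD, hSD, hD0⟩ := h.exists_tendsto_integral_abs hμ hγ hp.1 hcrit hv h2 h0 h1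
  have hmY := h.measurable
  have hmS : ∀ n, Measurable fun ω => RVSRRW.S ξ α β n ω / RVSRRW.sigma p μ n := fun n =>
    (Finset.measurable_sum _ fun k _ => hmY k).div_const _
  have hmM : ∀ n, Measurable fun ω => (2 * γ + 1) *
      (RVSRRW.a p μ n * RVSRRW.weightedSum μ Y id n ω / RVSRRW.v p μ n) := fun n =>
    ((((h.measurable_weightedSum measurable_id n).mono (h.le n) le_rfl).const_mul _).div_const _).const_mul _
  have hc : Tendsto (fun n => RVSRRW.a p μ n * μ n / RVSRRW.v p μ n) atTop (𝓝 0) := by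
    have := (hμ.tendsto_mul_sq_div_v_sq hγ hp.1 hcrit hv).sqrt
    rw [Real.sqrt_zero] at this
    refine squeeze_zero' ?_ ?_ this
    · filter_upwards [eventually_ge_atTop 1] with n hn
      exact div_nonneg (mul_pos (RVSRRW.a_pos hμ.1 hp.1 n) (hμ.1 n hn)).le (RVSRRW.v_nonneg _ _ _)
    · filter_upwards [eventually_ge_atTop 1] with n hn
      refine Real.le_sqrt_of_sq_le ?_
      rw [div_pow]
      have : (1 : ℝ) ≤ n := by exact_mod_cast hn
      gcongr
      exact le_mul_of_one_le_left (sq_nonneg _) this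
  refine ⟨fun n => (hmS n).aemeasurable, aemeasurable_id, ?_⟩
  refine ProbabilityMeasure.tendsto_of_tendsto_charFun fun t => ?_
  have hclt := h.tendsto_integral_cexp hμ.1 hp h2 h0 h1
    (hμ.tendsto_v_sq_div hγ hp.1 hcrit) hc (RVSRRW.tendsto_v hv) (t * (2 * γ + 1))
  have hdiff : Tendsto (fun n => ∫ ω, Complex.exp (Complex.I *
      (t * (RVSRRW.S ξ α β n ω / RVSRRW.sigma p μ n) : ℝ)) ∂P -
      ∫ ω, Complex.exp (Complex.I * (t * (2 * γ + 1) *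
        (RVSRRW.a p μ n * RVSRRW.weightedSum μ Y id n ω / RVSRRW.v p μ n) : ℝ)) ∂P) atTop (𝓝 0) := by
    have hD1 := hD0.const_mul |t|
    rw [mul_zero] at hD1
    refine squeeze_zero_norm' ?_ hD1
    filter_upwards [eventually_ge_atTop 1] with n hn
    simpa only [mul_assoc] using RVSRRW.norm_integral_cexp_sub_integral_cexp_le (hmS n) (hmM n)
      (hD n) (hSD n hn) t
  have hlim := hdiff.add hclt
  simp only [sub_add_cancel, zero_add] at hlim
  -- The formula also covers variance 0, so `γ = -1/2` needs no separate case.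
  have hchar : charFun (gaussianReal 0 (Real.toNNReal ((2 * γ + 1) ^ 2))) t =
      ((Real.exp (-((t * (2 * γ + 1)) ^ 2 / 2)) : ℝ) : ℂ) := by
    rw [charFun_gaussianReal, Real.coe_toNNReal _ (sq_nonneg _)]
    push_cast
    congr 1
    ring
  simp only [ProbabilityMeasure.coe_mk, Measure.map_id]
  rw [hchar]
  refine hlim.congr fun n => ?_
  rw [charFun_apply_real, integral_map (hmS n).aemeasurable (by fun_prop)]
  refine integral_congr_ae (Eventually.of_forall fun ω => ?_)
  dsimp only
  congr 1
  push_cast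
  ring
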